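/- Let $K\subset\mathbb R^3$ be a (tame) knot, and let $g(K)$ be its genus, the minimum genus of a compact connected orientable (tame) surface in $\mathbb R^3$ with boundary $K$. The length of a braid word in the generators $\sigma_1^{\pm1},\dots,\sigma_{n-1}^{\pm1}$ of the braid group $B_n$ is its number of letters (the number of crossings), and an $n$-braid represents $K$ if its closure is ambient isotopic to $K$. Let $br(K)$ be the braid index of $K$, the minimum number of strands of a braid representing $K$. For every integer $n\ge br(K)$ there is an $n$-braid representing $K$; let $b_n(K)$ be the minimum length of such a braid, and put $b_n'(K)=b_n(K)-n$. Then the function $n\mapsto b_n'(K)$ on $\{n\in\mathbb N: n\ge br(K)\}$ has the following properties: 1. it is nonincreasing, that is, $b_m'(K)\le b_n'(K)$ whenever $m\ge n\ge br(K)$; 2. $b_n'(K)\equiv 1 \pmod 2$ for all $n\ge br(K)$; 3. $b_n'(K)\ge 2g(K)-1$ for all $n\ge br(K)$. -/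

import Mathlib

noncomputable section

namespace BraidLength

/-- Three-dimensional space, with coordinates `![x, y, z]`. -/
abbrev R3 : Type := Fin 3 → ℝ

/-! ### Knots and isotopy -/

/-- `A` can be carried onto `B` by an ambient isotopy of `ℝ³`. -/
def AmbientIsotopic (A B : Set R3) : Prop :=
  ∃ F : unitInterval → (R3 ≃ₜ R3),
    Continuous (fun p : unitInterval × R3 => F p.1 p.2) ∧
    (∀ x, F 0 x = x) ∧ F 1 '' A = B

/-- `P` is a simple closed polygon with `m ≥ 3` vertices. -/
def IsSimpleClosedPolygon (P : Set R3) : Prop :=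
  ∃ m : ℕ, 3 ≤ m ∧ ∃ v : ZMod m → R3, Function.Injective v ∧
    (∀ i j, i ≠ j →
      segment ℝ (v i) (v (i + 1)) ∩ segment ℝ (v j) (v (j + 1)) ⊆
        {v i, v (i + 1)} ∩ {v j, v (j + 1)}) ∧
    P = ⋃ i, segment ℝ (v i) (v (i + 1))

/-- A (tame) knot: a subset of `ℝ³` that some homeomorphism of `ℝ³` carries onto a simple closed
polygon. -/
def IsKnot (K : Set R3) : Prop :=
  ∃ h : R3 ≃ₜ R3, IsSimpleClosedPolygon (h '' K)

/-! ### Braid words and their closures -/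

/-- Words in the generators `σ₁^±1, …, σ_{n-1}^±1` of the braid group on `n` strands.
The letter `(i, true)` is `σ_{i+1}` and `(i, false)` is its inverse. -/
abbrev BraidWord (n : ℕ) : Type := List (Fin (n - 1) × Bool)

/-- A point of `ℝ³`. -/
def pt (x y z : ℝ) : R3 := ![x, y, z]

/-- The part of the braid in the column `k ≤ x ≤ k + 1` that realizes one letter. The `n` strands
start and end at the heights `0, …, n - 1` in the plane `y = 0`. The strands at heights `i` and
`i + 1` are interchanged, the rising one passing on the side `y = 1` (and the falling one on the
side `y = -1`) for `σ_{i+1}`, and the other way round for the inverse; all others are straight. -/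
def crossingColumn (n k : ℕ) (a : Fin (n - 1) × Bool) : Set R3 :=
  let i : ℕ := a.1
  let ε : ℝ := if a.2 then 1 else -1
  (⋃ j ∈ {j : ℕ | j < n ∧ j ≠ i ∧ j ≠ i + 1}, segment ℝ (pt k 0 j) (pt (k + 1) 0 j)) ∪
  (segment ℝ (pt k 0 i) (pt (k + 1 / 2) ε (i + 1 / 2)) ∪
    segment ℝ (pt (k + 1 / 2) ε (i + 1 / 2)) (pt (k + 1) 0 (i + 1))) ∪
  (segment ℝ (pt k 0 (i + 1)) (pt (k + 1 / 2) (-ε) (i + 1 / 2)) ∪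
    segment ℝ (pt (k + 1 / 2) (-ε) (i + 1 / 2)) (pt (k + 1) 0 i))

/-- The arc in the plane `z = j` that joins the end `(c, 0, j)` of a braid with `c` letters to its
start `(0, 0, j)`, going around the braid axis `x = 1/2, y = -3/2`. -/
def closingArc (c j : ℕ) : Set R3 :=
  segment ℝ (pt c 0 j) (pt (c + 1) 0 j) ∪ segment ℝ (pt (c + 1) 0 j) (pt (c + 1) (-2) j) ∪
  segment ℝ (pt (c + 1) (-2) j) (pt 0 (-2) j) ∪ segment ℝ (pt 0 (-2) j) (pt 0 0 j)

/-- The closure of a braid word on `n` strands, as a closed braid around the axis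
`x = 1/2, y = -3/2`. -/
def closedBraid {n : ℕ} (w : BraidWord n) : Set R3 :=
  (⋃ k : Fin w.length, crossingColumn n k (w.get k)) ∪ ⋃ j : Fin n, closingArc w.length j

/-- The `n`-braid given by the word `w` represents `K`. -/
def Represents {n : ℕ} (w : BraidWord n) (K : Set R3) : Prop :=
  AmbientIsotopic (closedBraid w) K

/-- The braid index `br(K)`: the minimum number of strands of a braid representing `K`
(with the convention `⊤` for a set that no braid represents). -/
def braidIndex (K : Set R3) : ℕ∞ :=
  ⨅ n ∈ {n : ℕ | ∃ w : BraidWord n, Represents w K}, (n : ℕ∞)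

/-- The lengths (numbers of crossings) of the `n`-braids representing `K`. -/
def lengthSet (n : ℕ) (K : Set R3) : Set ℕ :=
  {c | ∃ w : BraidWord n, w.length = c ∧ Represents w K}

/-- `b_n(K)`: the minimum length of an `n`-braid representing `K`. -/
def b (n : ℕ) (K : Set R3) : ℕ := sInf (lengthSet n K)

/-- `b_n'(K) = b_n(K) - n`. -/
def b' (n : ℕ) (K : Set R3) : ℤ := (b n K : ℤ) - n

/-! ### Seifert surfaces and the genus -/

/-- The `d`-dimensional simplices. -/
def simplices (T : Geometry.SimplicialComplex ℝ R3) (d : ℕ) : Set (Finset R3) :=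
  {s | s ∈ T.faces ∧ s.card = d + 1}

/-- The triangles that contain the simplex `e`. -/
def trianglesAt (T : Geometry.SimplicialComplex ℝ R3) (e : Finset R3) : Set (Finset R3) :=
  {t | t ∈ simplices T 2 ∧ e ⊆ t}

/-- An orientation of all triangles such that any two triangles with a common edge induce
opposite directions on it. Here `o t a b` says that the boundary of the oriented triangle `t`
runs along its edge `ab` from `a` to `b`. -/
def IsOrientable (T : Geometry.SimplicialComplex ℝ R3) : Prop :=
  ∃ o : Finset R3 → R3 → R3 → Prop,
    (∀ t ∈ simplices T 2, ∀ a ∈ t, ∀ b ∈ t, ∀ c ∈ t, a ≠ b → b ≠ c → a ≠ c →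
      (o t a b ↔ o t b c) ∧ (o t a b ↔ ¬ o t b a)) ∧
    (∀ t ∈ simplices T 2, ∀ t' ∈ simplices T 2, t ≠ t' →
      ∀ a b, a ≠ b → a ∈ t → b ∈ t → a ∈ t' → b ∈ t' → (o t a b ↔ o t' b a))

/-- The complex triangulates a compact connected orientable surface with (possibly empty)
boundary. -/
structure IsSurface (T : Geometry.SimplicialComplex ℝ R3) : Prop where
  finite : T.faces.Finite
  /-- Every simplex is a face of a triangle. -/
  pure : ∀ s ∈ T.faces, ∃ t ∈ simplices T 2, s ⊆ t
  /-- Every edge lies in one or two triangles. -/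
  edge : ∀ e ∈ simplices T 1, (trianglesAt T e).ncard = 1 ∨ (trianglesAt T e).ncard = 2
  /-- The link of every vertex is connected (so that it is an arc or a circle): one gets from any
  triangle at `v` to any other one through triangles at `v`, crossing edges at `v`. -/
  link : ∀ v ∈ T.vertices, ∀ s ∈ trianglesAt T {v}, ∀ t ∈ trianglesAt T {v},
    Relation.ReflTransGen
      (fun s' t' => ∃ e ∈ simplices T 1, v ∈ e ∧ s' ∈ trianglesAt T e ∧ t' ∈ trianglesAt T e) s t
  connected : IsConnected T.space
  orientable : IsOrientable T

/-- The boundary of a triangulated surface: the union of the edges lying in only one triangle. -/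
def boundary (T : Geometry.SimplicialComplex ℝ R3) : Set R3 :=
  ⋃ e ∈ {e | e ∈ simplices T 1 ∧ (trianglesAt T e).ncard = 1}, convexHull ℝ (e : Set R3)

/-- The Euler characteristic of a triangulated surface. -/
def eulerChar (T : Geometry.SimplicialComplex ℝ R3) : ℤ :=
  (simplices T 0).ncard - (simplices T 1).ncard + (simplices T 2).ncard

/-- `S` is a (tame) Seifert surface of genus `g` for the knot `K`: some homeomorphism of `ℝ³`
carries `S` onto a polyhedral compact connected orientable surface and `K` onto its boundary.
As there is one boundary component, the genus is given by `χ(S) = 1 - 2g`. -/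
def IsSeifertSurface (S K : Set R3) (g : ℕ) : Prop :=
  ∃ (h : R3 ≃ₜ R3) (T : Geometry.SimplicialComplex ℝ R3),
    IsSurface T ∧ h '' S = T.space ∧ h '' K = boundary T ∧ eulerChar T = 1 - 2 * (g : ℤ)

/-- The genus of a knot: the minimum genus of its Seifert surfaces. -/
def genus (K : Set R3) : ℕ := sInf {g | ∃ S, IsSeifertSurface S K g}

end BraidLength

end

/-!
Markov stabilization adds one strand and one crossing to a braid. It does not change the closure up
to ambient isotopy, as it only pulls a loop out of the topmost closing arc. Hence `b'` is antitone.

For the other two claims take a braid word with `n` strands and `c` crossings whose closure is a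
knot. Its `n` strands bound disks, which half-twisted bands at the `c` crossings join to an
orientable surface with `χ = n - c`. As its boundary is connected, the permutation of the strands is
an `n`-cycle, which is a product of `c` transpositions; hence `c ≡ n - 1` modulo `2`. So
`c - n = 2g - 1` for an integer `g`, which is the genus of the surface.
-/

noncomputable section

namespace BraidLength

/-! ### Ambient isotopies -/

theorem AmbientIsotopic.trans {A B C : Set R3} (h₁ : AmbientIsotopic A B)
    (h₂ : AmbientIsotopic B C) : AmbientIsotopic A C := by
  obtain ⟨F, hF, hF0, hF1⟩ := h₁
  obtain ⟨G, hG, hG0, hG1⟩ := h₂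
  refine ⟨fun t => (F t).trans (G t), hG.comp (continuous_fst.prodMk hF),
    fun x => by simp [hF0, hG0], ?_⟩
  rw [← hG1, ← hF1, Set.image_image]
  rfl

theorem AmbientIsotopic.symm {A B : Set R3} (h : AmbientIsotopic A B) : AmbientIsotopic B A := by
  obtain ⟨F, hF, hF0, hF1⟩ := h
  refine ⟨fun t => (F 1).symm.trans (F (unitInterval.symm t)), ?_, fun x => by simp, ?_⟩
  · exact hF.comp ((unitInterval.continuous_symm.comp continuous_fst).prodMk
      ((F 1).symm.continuous.comp continuous_snd))
  · rw [← hF1, Set.image_image]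
    simp [hF0]

section push

variable {ι : Type*} [DecidableEq ι] {i : ι} {d : (ι → ℝ) → ℝ}

/-- The displacement of every point `p` by `d p` in the direction of the `i`-th axis. -/
def push (i : ι) (d : (ι → ℝ) → ℝ) (p : ι → ℝ) : ι → ℝ :=
  Function.update p i (p i + d p)

theorem push_eq_self {p : ι → ℝ} (h : d p = 0) : push i d p = p := by
  rw [push, h, add_zero, Function.update_eq_self]

theorem continuous_push (hd : Continuous d) : Continuous (push i d) :=
  continuous_id.update i ((continuous_apply i).add hd)

theorem strictMono_push_update (hmono : ∀ p, Monotone fun s => d (Function.update p i s))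
    (p : ι → ℝ) : StrictMono fun s => push i d (Function.update p i s) i := by
  simpa only [push, Function.update_self, id] using strictMono_id.add_monotone (hmono p)

theorem injective_push (hmono : ∀ p, Monotone fun s => d (Function.update p i s)) :
    Function.Injective (push i d) := by
  intro p q h
  have hq : Function.update p i (q i) = q := by
    refine Function.update_eq_iff.2 ⟨rfl, fun j hj => ?_⟩
    simpa [push, hj] using congrFun h j
  have hpq : p i = q i :=
    (strictMono_push_update hmono p).injective (by simpa [hq] using congrFun h i)
  rw [← hq, ← hpq, Function.update_eq_self]

theorem surjective_push (hd : Continuous d)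
    (hmono : ∀ p, Monotone fun s => d (Function.update p i s)) :
    Function.Surjective (push i d) := by
  intro q
  have hF : Continuous fun s => s + d (Function.update q i s) :=
    continuous_id.add (hd.comp (continuous_const.update i continuous_id))
  have hq : d (Function.update q i (q i)) = d q := by rw [Function.update_eq_self]
  obtain ⟨s, hs⟩ : q i ∈ Set.range fun s => s + d (Function.update q i s) := by
    rcases le_total 0 (d q) with h | h
    · have := hmono q (by linarith : q i - d q ≤ q i)
      exact mem_range_of_exists_le_of_exists_ge hF ⟨q i - d q, by linarith⟩ ⟨q i, by linarith⟩
    · have := hmono q (by linarith : q i ≤ q i - d q)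
      exact mem_range_of_exists_le_of_exists_ge hF ⟨q i, by linarith⟩ ⟨q i - d q, by linarith⟩
  exact ⟨Function.update q i s, by simpa [push] using congrArg (Function.update q i) hs⟩

theorem continuous_of_push_eq (hd : Continuous d)
    (hmono : ∀ p, Monotone fun s => d (Function.update p i s)) {g : (ι → ℝ) → ι → ℝ}
    (hg : ∀ q, push i d (g q) = q) : Continuous g := by
  have hne (q : ι → ℝ) {j : ι} (hj : j ≠ i) : g q j = q j := by
    simpa [push, hj] using congrFun (hg q) j
  have hvalue (q : ι → ℝ) : push i d (Function.update q i (g q i)) i = q i := by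
    rw [Function.update_eq_iff.2 ⟨rfl, fun j hj => (hne q hj).symm⟩, hg]
  have hcont (a : ℝ) : Continuous fun q => push i d (Function.update q i a) i :=
    (continuous_apply i).comp
      ((continuous_push hd).comp (continuous_id.update i continuous_const))
  have hlt (q : ι → ℝ) (a : ℝ) : a < g q i ↔ push i d (Function.update q i a) i < q i := by
    conv_rhs => rw [← hvalue q, (strictMono_push_update hmono q).lt_iff_lt]
  have hgt (q : ι → ℝ) (a : ℝ) : g q i < a ↔ q i < push i d (Function.update q i a) i := by
    conv_rhs => rw [← hvalue q, (strictMono_push_update hmono q).lt_iff_lt]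
  refine continuous_pi fun j => ?_
  by_cases hj : j = i
  · subst hj
    refine OrderTopology.continuous_iff.2 fun a => ⟨?_, ?_⟩
    · simpa only [Set.preimage, Set.mem_Ioi, hlt] using isOpen_lt (hcont a) (continuous_apply j)
    · simpa only [Set.preimage, Set.mem_Iio, hgt] using isOpen_lt (continuous_apply j) (hcont a)
  · simpa only [hne _ hj] using continuous_apply j

theorem bijective_push (hd : Continuous d)
    (hmono : ∀ p, Monotone fun s => d (Function.update p i s)) : Function.Bijective (push i d) :=
  ⟨injective_push hmono, surjective_push hd hmono⟩

/-- `push i d` as a homeomorphism, for a continuous displacement that increases along the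
`i`-th axis. -/
def pushHomeomorph (i : ι) (hd : Continuous d)
    (hmono : ∀ p, Monotone fun s => d (Function.update p i s)) : (ι → ℝ) ≃ₜ (ι → ℝ) where
  toEquiv := Equiv.ofBijective (push i d) (bijective_push hd hmono)
  continuous_toFun := continuous_push hd
  continuous_invFun := continuous_of_push_eq hd hmono
    (Equiv.ofBijective_apply_symm_apply _ (bijective_push hd hmono))

theorem ambientIsotopic_image_push {i : Fin 3} {d : R3 → ℝ} (hd : Continuous d)
    (hmono : ∀ p, Monotone fun s => d (Function.update p i s)) (A : Set R3) :
    AmbientIsotopic A (push i d '' A) := by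
  refine ⟨fun t => pushHomeomorph i (d := fun p => t * d p) (by fun_prop)
    fun p => (hmono p).const_mul t.2.1, ?_,
    fun x => push_eq_self (d := fun p => 0 * d p) (zero_mul _), ?_⟩
  · change Continuous fun q : unitInterval × R3 => Function.update q.2 i (q.2 i + q.1 * d q.2)
    exact continuous_snd.update i (by fun_prop)
  · change push i (fun p => 1 * d p) '' A = _
    simp only [one_mul]

end push

@[simp] theorem pt_zero (x y z : ℝ) : pt x y z 0 = x := rfl
@[simp] theorem pt_one (x y z : ℝ) : pt x y z 1 = y := rfl
@[simp] theorem pt_two (x y z : ℝ) : pt x y z 2 = z := rfl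

theorem R3_ext {p q : R3} (h0 : p 0 = q 0) (h1 : p 1 = q 1) (h2 : p 2 = q 2) : p = q := by
  ext i; fin_cases i <;> assumption

@[fun_prop] theorem continuous_pt {X : Type*} [TopologicalSpace X] {f g h : X → ℝ}
    (hf : Continuous f) (hg : Continuous g) (hh : Continuous h) :
    Continuous fun x => pt (f x) (g x) (h x) := by
  refine continuous_pi fun i => ?_
  fin_cases i <;> assumption

theorem push_zero_pt (d : R3 → ℝ) (x y z : ℝ) :
    push 0 d (pt x y z) = pt (x + d (pt x y z)) y z := by
  apply R3_ext <;> simp [push]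

theorem push_two_pt (d : R3 → ℝ) (x y z : ℝ) :
    push 2 d (pt x y z) = pt x y (z + d (pt x y z)) := by
  apply R3_ext <;> simp [push]

/-- The point at height `h` above the point `z` of the complex plane. -/
def ofPlane (z : ℂ) (h : ℝ) : R3 := pt z.re z.im h

/-- The projection of `ℝ³` to the first two coordinates. -/
def toPlane (p : R3) : ℂ := ⟨p 0, p 1⟩

@[simp] theorem toPlane_ofPlane (z : ℂ) (h : ℝ) : toPlane (ofPlane z h) = z := rfl

@[simp] theorem ofPlane_two (z : ℂ) (h : ℝ) : ofPlane z h 2 = h := rfl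

theorem ofPlane_toPlane (p : R3) : ofPlane (toPlane p) (p 2) = p := R3_ext rfl rfl rfl

@[fun_prop] theorem continuous_ofPlane {X : Type*} [TopologicalSpace X] {f : X → ℂ} {g : X → ℝ}
    (hf : Continuous f) (hg : Continuous g) : Continuous fun x => ofPlane (f x) (g x) := by
  unfold ofPlane
  fun_prop

@[fun_prop] theorem continuous_toPlane : Continuous toPlane := by
  have : toPlane = fun p => (p 0 : ℂ) + p 1 * Complex.I := by
    ext p
    apply Complex.ext <;> simp [toPlane]
  rw [this]
  fun_prop

/-- The map that acts on the horizontal plane at height `h` as the similarity carrying `a h` to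
`u h` and `b h` to `v h`. -/
def twist (a b u v : ℝ → ℂ) (p : R3) : R3 :=
  ofPlane (u (p 2) + (v (p 2) - u (p 2)) * (toPlane p - a (p 2)) / (b (p 2) - a (p 2))) (p 2)

section twist

variable {a b u v : ℝ → ℂ}

theorem twist_lineMap {h : ℝ} (hab : a h ≠ b h) (t : ℝ) :
    twist a b u v (ofPlane (AffineMap.lineMap (a h) (b h) t) h) =
      ofPlane (AffineMap.lineMap (u h) (v h) t) h := by
  have h1 := sub_ne_zero.2 hab.symm
  simp only [twist, toPlane_ofPlane, ofPlane_two, AffineMap.lineMap_apply_module']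
  congr 1
  rw [add_sub_cancel_right, mul_smul_comm, smul_div_assoc, mul_div_cancel_right₀ _ h1, add_comm]

theorem twist_left {h : ℝ} (hab : a h ≠ b h) :
    twist a b u v (ofPlane (a h) h) = ofPlane (u h) h := by
  simpa using twist_lineMap (u := u) (v := v) hab 0

theorem twist_right {h : ℝ} (hab : a h ≠ b h) :
    twist a b u v (ofPlane (b h) h) = ofPlane (v h) h := by
  simpa using twist_lineMap (u := u) (v := v) hab 1

theorem twist_twist (hab : ∀ h, a h ≠ b h) (huv : ∀ h, u h ≠ v h) (p : R3) :
    twist u v a b (twist a b u v p) = p := by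
  conv_rhs => rw [← ofPlane_toPlane p]
  have h1 := sub_ne_zero.2 (hab (p 2)).symm
  have h2 := sub_ne_zero.2 (huv (p 2)).symm
  simp only [twist, ofPlane_two, toPlane_ofPlane]
  congr 1
  field_simp
  ring

theorem twist_eq_self (hab : ∀ h, a h ≠ b h) {p : R3} (ha : a (p 2) = u (p 2))
    (hb : b (p 2) = v (p 2)) : twist a b u v p = p := by
  conv_rhs => rw [← ofPlane_toPlane p]
  have h1 := sub_ne_zero.2 (hab (p 2)).symm
  rw [twist, ← ha, ← hb]
  congr 1
  field_simp
  ring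

theorem ambientIsotopic_image_twist (ha : Continuous a) (hb : Continuous b) (hu : Continuous u)
    (hv : Continuous v) (hab : ∀ h, a h ≠ b h) (huv : ∀ h, u h ≠ v h) (hau : a 0 = u 0)
    (hbv : b 0 = v 0) (A : Set R3) : AmbientIsotopic A (twist a b u v '' A) := by
  have hne {a b : ℝ → ℂ} (hab : ∀ h, a h ≠ b h) (h : ℝ) : b h - a h ≠ 0 :=
    sub_ne_zero.2 (hab h).symm
  have hcont {a b u v : ℝ → ℂ} (ha : Continuous a) (hb : Continuous b) (hu : Continuous u)
      (hv : Continuous v) (hab : ∀ h, a h ≠ b h) :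
      Continuous fun q : ℝ × R3 =>
        twist (fun h => a (q.1 * h)) (fun h => b (q.1 * h)) (fun h => u (q.1 * h))
          (fun h => v (q.1 * h)) q.2 := by
    unfold twist
    fun_prop (disch := exact fun _ => hne hab _)
  -- Rescaling the heights by `t` deforms the twist to the identity, since `a 0 = u 0`, `b 0 = v 0`.
  refine ⟨fun t =>
    { toFun := twist (fun h => a (t * h)) (fun h => b (t * h)) (fun h => u (t * h))
        (fun h => v (t * h))
      invFun := twist (fun h => u (t * h)) (fun h => v (t * h)) (fun h => a (t * h))
        (fun h => b (t * h))
      left_inv := twist_twist (fun _ => hab _) fun _ => huv _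
      right_inv := twist_twist (fun _ => huv _) fun _ => hab _
      continuous_toFun := (hcont ha hb hu hv hab).comp (Continuous.prodMk_right (t : ℝ))
      continuous_invFun :=
        (hcont hu hv ha hb huv).comp (Continuous.prodMk_right (t : ℝ)) }, ?_, ?_, ?_⟩
  · exact (hcont ha hb hu hv hab).comp
      (by fun_prop : Continuous fun q : unitInterval × R3 => ((q.1 : ℝ), q.2))
  · intro x
    exact twist_eq_self (a := fun h => a (0 * h)) (u := fun h => u (0 * h))
      (v := fun h => v (0 * h)) (fun _ => hab _) (by simpa using hau) (by simpa using hbv)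
  · simp

end twist

/-! ### Segments -/

theorem lineMap_pt (x y z x' y' z' t : ℝ) :
    AffineMap.lineMap (pt x y z) (pt x' y' z') t =
      pt (x + t * (x' - x)) (y + t * (y' - y)) (z + t * (z' - z)) := by
  apply R3_ext <;> simp [AffineMap.lineMap_apply, add_comm]

section segment

variable {E F : Type*} [AddCommGroup E] [Module ℝ E] [AddCommGroup F] [Module ℝ F]

theorem image_segment_eq_segment {f : E → F} {p q : E} {p' q' : F}
    (h : ∀ t ∈ Set.Icc (0 : ℝ) 1, f (AffineMap.lineMap p q t) = AffineMap.lineMap p' q' t) :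
    f '' segment ℝ p q = segment ℝ p' q' := by
  rw [segment_eq_image_lineMap, segment_eq_image_lineMap, Set.image_image]
  exact Set.image_congr h

theorem image_Icc_eq_segment {f : ℝ → F} {a b : ℝ} (hab : a ≤ b) {p q : F}
    (h : ∀ t ∈ Set.Icc (0 : ℝ) 1, f (a + t * (b - a)) = AffineMap.lineMap p q t) :
    f '' Set.Icc a b = segment ℝ p q := by
  rw [← segment_eq_Icc hab]
  refine image_segment_eq_segment fun t ht => ?_
  rw [← h t ht, AffineMap.lineMap_apply_ring', add_comm, mul_comm]

end segment

theorem segment_along_x {a b : ℝ} (h : a ≤ b) (y z : ℝ) :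
    segment ℝ (pt a y z) (pt b y z) = (fun x => pt x y z) '' Set.Icc a b :=
  (image_Icc_eq_segment h fun t _ => by simp [lineMap_pt]).symm

theorem segment_along_x_union {a b c : ℝ} (hab : a ≤ b) (hbc : b ≤ c) (y z : ℝ) :
    segment ℝ (pt a y z) (pt b y z) ∪ segment ℝ (pt b y z) (pt c y z) =
      segment ℝ (pt a y z) (pt c y z) := by
  rw [segment_along_x hab, segment_along_x hbc, segment_along_x (hab.trans hbc), ← Set.image_union,
    Set.Icc_union_Icc_eq_Icc hab hbc]

/-! ### The loop added by a stabilization -/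

/-- The point of `[0, b]` nearest to `x`. -/
def cutoff (b x : ℝ) : ℝ := max 0 (min x b)

section cutoff

variable {b x : ℝ}

@[fun_prop] theorem continuous_cutoff (b : ℝ) : Continuous (cutoff b) := by
  unfold cutoff; fun_prop

theorem monotone_cutoff (b : ℝ) : Monotone (cutoff b) := fun x y h => by
  unfold cutoff; gcongr

theorem cutoff_nonneg (b x : ℝ) : 0 ≤ cutoff b x := le_max_left _ _

theorem cutoff_le (hb : 0 ≤ b) (x : ℝ) : cutoff b x ≤ b := max_le hb (min_le_right _ _)

theorem cutoff_of_nonpos (h : x ≤ 0) : cutoff b x = 0 :=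
  max_eq_left ((min_le_left _ _).trans h)

theorem cutoff_of_mem (h0 : 0 ≤ x) (h1 : x ≤ b) : cutoff b x = x := by
  rw [cutoff, min_eq_left h1, max_eq_right h0]

theorem cutoff_of_le (hb : 0 ≤ b) (h : b ≤ x) : cutoff b x = b := by
  rw [cutoff, min_eq_right h, max_eq_right hb]

end cutoff

/-- The `x`-coordinate at height `s` of an arm of length `ℓ` of the loop, relative to the middle
of the crossing: the arm crosses over from `-1/2` to `1/2` below the height `1`, goes on to
`1/2 + ℓ` and stays there. -/
def armX (ℓ s : ℝ) : ℝ := min s 1 - 1 / 2 + min ((ℓ + 2) / 2 * max (s - 1) 0) ℓ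

/-- The `y`-coordinate at height `s` of an arm of length `ℓ` of the loop: the arm makes a detour to
`σ` below the height `1`, and descends to `-2` as soon as its `x`-coordinate is `1/2 + ℓ`. -/
def armY (σ ℓ s : ℝ) : ℝ :=
  σ * (2 * min (min s 1) (1 - min s 1)) - max ((ℓ + 2) / 2 * max (s - 1) 0 - ℓ) 0

/-- The arm of length `ℓ` of the loop on the side `x = σ`, with a detour to the side `y = σ` below
the height `1`. -/
def arm (σ ℓ s : ℝ) : ℂ := ⟨σ * armX ℓ s, armY σ ℓ s⟩

section arm

variable {σ ℓ s : ℝ}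

@[fun_prop] theorem continuous_arm (σ ℓ : ℝ) : Continuous (arm σ ℓ) := by
  have : arm σ ℓ = fun s => ((σ * armX ℓ s : ℝ) : ℂ) + (armY σ ℓ s : ℝ) * Complex.I := by
    ext s
    apply Complex.ext <;> simp [arm]
  rw [this]
  unfold armX armY
  fun_prop

theorem armX_of_le (hℓ : 0 ≤ ℓ) (h1 : s ≤ 1) : armX ℓ s = s - 1 / 2 := by
  simp [armX, h1, hℓ]

theorem armY_of_le (hℓ : 0 ≤ ℓ) (h1 : s ≤ 1) : armY σ ℓ s = σ * (2 * min s (1 - s)) := by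
  simp [armY, h1, hℓ]

theorem armX_of_ge (h1 : 1 ≤ s) : armX ℓ s = 1 / 2 + min ((ℓ + 2) / 2 * (s - 1)) ℓ := by
  simp only [armX, min_eq_right h1, max_eq_left (sub_nonneg.2 h1)]
  norm_num

theorem armY_of_ge (h1 : 1 ≤ s) : armY σ ℓ s = -max ((ℓ + 2) / 2 * (s - 1) - ℓ) 0 := by
  simp [armY, h1]

theorem armX_lt_zero (hℓ : 0 ≤ ℓ) (hs : s < 1 / 2) : armX ℓ s < 0 := by
  rw [armX_of_le hℓ (by linarith)]
  linarith

theorem zero_lt_armX (hℓ : 0 ≤ ℓ) (hs : 1 / 2 < s) : 0 < armX ℓ s := by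
  rcases le_total s 1 with h | h
  · rw [armX_of_le hℓ h]
    linarith
  · rw [armX_of_ge h]
    have : 0 ≤ min ((ℓ + 2) / 2 * (s - 1)) ℓ :=
      le_min (mul_nonneg (by linarith) (by linarith)) hℓ
    linarith

theorem arm_ne_arm {ℓ ℓ' : ℝ} (hℓ : 0 ≤ ℓ) (hℓ' : 0 ≤ ℓ') (s : ℝ) : arm 1 ℓ s ≠ arm (-1) ℓ' s := by
  intro h
  have hx : 1 * armX ℓ s = -1 * armX ℓ' s := congrArg Complex.re h
  have hy : armY 1 ℓ s = armY (-1) ℓ' s := congrArg Complex.im h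
  rcases lt_trichotomy s (1 / 2) with hs | rfl | hs
  · linarith [armX_lt_zero hℓ hs, armX_lt_zero hℓ' hs]
  · rw [armY_of_le hℓ (by norm_num), armY_of_le hℓ' (by norm_num)] at hy
    norm_num at hy
  · linarith [zero_lt_armX hℓ hs, zero_lt_armX hℓ' hs]

theorem arm_zero (hℓ : 0 ≤ ℓ) : arm σ ℓ 0 = ⟨-σ / 2, 0⟩ := by
  rw [arm, armX_of_le hℓ zero_le_one, armY_of_le hℓ zero_le_one]
  apply Complex.ext
  · change σ * (0 - 1 / 2) = -σ / 2
    ring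
  · simp

theorem arm_three : arm σ ℓ 3 = ⟨σ * (1 / 2 + ℓ), -2⟩ := by
  rw [arm, armX_of_ge (by norm_num), armY_of_ge (by norm_num), min_eq_right (by linarith),
    max_eq_left (by linarith)]
  congr 1
  ring

end arm

/-- The height that an arm `armX`, `armY` reaches above the point `(x, y)`, up to scale and
translation. -/
def armHeight (x y : ℝ) : ℝ := max (x - 1 / 2) 0 + max (-y - 2 * max (1 / 2 - x) 0) 0

/-- The height that the two arms `arm 1 ℓ` and `arm (-1) ℓ'` and a segment joining their ends reach
above the point `(x, y)`. -/
def loopHeight (ℓ ℓ' x y : ℝ) : ℝ :=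
  1 + max (max (2 / (ℓ + 2) * armHeight x y) (2 / (ℓ' + 2) * armHeight (-x) y))
    (2 * cutoff 1 (-1 - y))

section loopHeight

variable {ℓ ℓ' s x y : ℝ}

theorem loopHeight_neg : loopHeight ℓ ℓ' (-x) y = loopHeight ℓ' ℓ x y := by
  rw [loopHeight, neg_neg, max_comm (2 / (ℓ + 2) * _), loopHeight]

theorem one_le_loopHeight : 1 ≤ loopHeight ℓ ℓ' x y :=
  le_add_of_nonneg_right (le_max_of_le_right (mul_nonneg zero_le_two (cutoff_nonneg _ _)))

theorem continuous_loopHeight : Continuous fun z : ℂ => loopHeight ℓ ℓ' z.re z.im := by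
  unfold loopHeight armHeight
  fun_prop

theorem armHeight_eq_zero (hx : x ≤ 1 / 2) (hxy : -y ≤ 1 - 2 * x) : armHeight x y = 0 := by
  have hx' : max (1 / 2 - x) 0 = 1 / 2 - x := max_eq_left (by linarith)
  rw [armHeight, hx', max_eq_right (by linarith), max_eq_right (by linarith), add_zero]

theorem armHeight_of_ge (hx : 1 / 2 ≤ x) (hy : y ≤ 0) : armHeight x y = x - 1 / 2 - y := by
  have hx' : max (1 / 2 - x) 0 = 0 := max_eq_right (by linarith)
  rw [armHeight, hx', max_eq_left (by linarith), max_eq_left (by linarith)]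
  ring

theorem loopHeight_arm_of_le {σ : ℝ} (hℓ : 0 ≤ ℓ) (hσ : |σ| ≤ 1) (h0 : 0 ≤ s) (h1 : s ≤ 1) :
    loopHeight ℓ ℓ' (armX ℓ s) (armY σ ℓ s) = 1 := by
  have hy : -armY σ ℓ s ≤ 2 * min s (1 - s) := by
    rw [armY_of_le hℓ h1, neg_mul_eq_neg_mul]
    exact mul_le_of_le_one_left (mul_nonneg zero_le_two (le_min h0 (by linarith)))
      ((neg_le_abs σ).trans hσ)
  have hs := min_le_left s (1 - s)
  have hs' := min_le_right s (1 - s)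
  rw [loopHeight, armX_of_le hℓ h1, armHeight_eq_zero (by linarith) (by linarith),
    armHeight_eq_zero (by linarith) (by linarith), cutoff_of_nonpos (by linarith)]
  simp

theorem loopHeight_arm_of_ge {σ : ℝ} (hℓ : 0 ≤ ℓ) (h1 : 1 ≤ s) (h3 : s ≤ 3) :
    loopHeight ℓ ℓ' (armX ℓ s) (armY σ ℓ s) = s := by
  obtain ⟨d, hd⟩ : ∃ d, (ℓ + 2) / 2 * (s - 1) = d := ⟨_, rfl⟩
  have hs : 1 + 2 / (ℓ + 2) * d = s := by rw [← hd]; field_simp; ring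
  have hd0 : 0 ≤ d := hd ▸ mul_nonneg (by linarith) (by linarith)
  have hd3 : d ≤ ℓ + 2 := by nlinarith
  have hmin : 0 ≤ min d ℓ := le_min hd0 hℓ
  have hmax : max (d - ℓ) 0 ≤ 2 := max_le (by linarith) zero_le_two
  have hsum : min d ℓ + max (d - ℓ) 0 = d := by
    rcases le_total d ℓ with h | h <;> simp [h]
  have hcut : 2 * cutoff 1 (-1 - -max (d - ℓ) 0) ≤ 2 / (ℓ + 2) * d := by
    rw [div_mul_eq_mul_div, le_div_iff₀ (by linarith)]
    rcases le_total d (ℓ + 1) with h | h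
    · rw [cutoff_of_nonpos (by linarith [max_le (by linarith : d - ℓ ≤ 1) zero_le_one])]
      linarith
    · rw [max_eq_left (by linarith), cutoff_of_mem (by linarith) (by linarith)]
      nlinarith
  rw [loopHeight, armX_of_ge h1, armY_of_ge h1, hd,
    armHeight_of_ge (by linarith) (neg_nonpos.2 (le_max_right _ _)),
    armHeight_eq_zero (by linarith) (by linarith), mul_zero]
  have hsum' : 1 / 2 + min d ℓ - 1 / 2 - -max (d - ℓ) 0 = d := by linarith
  have hnonneg : 0 ≤ 2 / (ℓ + 2) * d := by positivity
  rw [hsum', max_eq_left hnonneg, max_eq_left hcut, hs]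

theorem armHeight_neg_two_le (hℓ : 0 ≤ ℓ) (hx : x ≤ 1 / 2 + ℓ) : armHeight x (-2) ≤ ℓ + 2 := by
  have h1 : max (x - 1 / 2) 0 ≤ ℓ := max_le (by linarith) hℓ
  have h2 : max (- -2 - 2 * max (1 / 2 - x) 0) 0 ≤ 2 :=
    max_le (by linarith [le_max_right (1 / 2 - x) 0]) zero_le_two
  exact add_le_add h1 h2

theorem loopHeight_neg_two (hℓ : 0 ≤ ℓ) (hℓ' : 0 ≤ ℓ') (h0 : -(1 / 2 + ℓ') ≤ x)
    (h1 : x ≤ 1 / 2 + ℓ) : loopHeight ℓ ℓ' x (-2) = 3 := by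
  have key {ℓ x : ℝ} (hℓ : 0 ≤ ℓ) (hx : x ≤ 1 / 2 + ℓ) :
      2 / (ℓ + 2) * armHeight x (-2) ≤ 2 * 1 := by
    rw [div_mul_eq_mul_div, div_le_iff₀ (by linarith)]
    linarith [armHeight_neg_two_le hℓ hx]
  rw [loopHeight, cutoff_of_le zero_le_one (by norm_num),
    max_eq_right (max_le (key hℓ h1) (key hℓ' (by linarith)))]
  norm_num

theorem loopHeight_arm {σ : ℝ} (hℓ : 0 ≤ ℓ) (hσ : |σ| ≤ 1) (h0 : 0 ≤ s) (h3 : s ≤ 3) :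
    loopHeight ℓ ℓ' (armX ℓ s) (armY σ ℓ s) = max s 1 := by
  rcases le_total s 1 with h | h
  · rw [loopHeight_arm_of_le hℓ hσ h0 h, max_eq_right h]
  · rw [loopHeight_arm_of_ge hℓ h h3, max_eq_left h]

end loopHeight

/-- The arm of the loop itself: it rises only to the height `1` above its start. -/
def flatArm (x m σ ℓ s : ℝ) : R3 := ofPlane (x + arm σ ℓ s) (m + min s 1)

/-- The arm of the loop stretched in the vertical direction so that it rises steadily. -/
def risingArm (x m σ ℓ s : ℝ) : R3 := ofPlane (x + arm σ ℓ s) (m + s)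

theorem flatArm_eq_pt (x m σ ℓ s : ℝ) :
    flatArm x m σ ℓ s = pt (x + σ * armX ℓ s) (armY σ ℓ s) (m + min s 1) := by
  simp [flatArm, ofPlane, arm]

theorem image_flatArm_crossing {x m σ ℓ : ℝ} (hℓ : 0 ≤ ℓ) :
    flatArm x m σ ℓ '' Set.Icc 0 1 =
      segment ℝ (pt (x - σ / 2) 0 m) (pt x σ (m + 1 / 2)) ∪
        segment ℝ (pt x σ (m + 1 / 2)) (pt (x + σ / 2) 0 (m + 1)) := by
  rw [← Set.Icc_union_Icc_eq_Icc (by norm_num : (0 : ℝ) ≤ 1 / 2) (by norm_num), Set.image_union]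
  congr 1 <;> refine image_Icc_eq_segment (by norm_num) fun t ⟨h0, h1⟩ => ?_
  · rw [flatArm_eq_pt, lineMap_pt, armX_of_le hℓ (by linarith), armY_of_le hℓ (by linarith),
      min_eq_left (by linarith), min_eq_left (by linarith)]
    congr 1 <;> ring
  · rw [flatArm_eq_pt, lineMap_pt, armX_of_le hℓ (by linarith), armY_of_le hℓ (by linarith),
      min_eq_right (by linarith), min_eq_left (by linarith)]
    congr 1 <;> ring

theorem image_flatArm_outside {x m σ ℓ : ℝ} (hℓ : 0 ≤ ℓ) :
    flatArm x m σ ℓ '' Set.Icc 1 3 =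
      segment ℝ (pt (x + σ / 2) 0 (m + 1)) (pt (x + σ * (1 / 2 + ℓ)) 0 (m + 1)) ∪
        segment ℝ (pt (x + σ * (1 / 2 + ℓ)) 0 (m + 1))
          (pt (x + σ * (1 / 2 + ℓ)) (-2) (m + 1)) := by
  obtain ⟨r, hr⟩ : ∃ r, 2 * ℓ / (ℓ + 2) = r := ⟨_, rfl⟩
  have hrℓ : (ℓ + 2) / 2 * r = ℓ := by rw [← hr]; field_simp
  have hr0 : 0 ≤ r := by rw [← hr]; positivity
  have hr2 : r ≤ 2 := by nlinarith
  rw [← Set.Icc_union_Icc_eq_Icc (by linarith : 1 ≤ 1 + r) (by linarith : 1 + r ≤ 3),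
    Set.image_union]
  congr 1 <;> refine image_Icc_eq_segment (by linarith) fun t ⟨h0, h1⟩ => ?_
  · have hd : (ℓ + 2) / 2 * (1 + t * (1 + r - 1) - 1) = t * ℓ := by linear_combination t * hrℓ
    have htr : 0 ≤ t * r := mul_nonneg h0 hr0
    rw [flatArm_eq_pt, lineMap_pt, armX_of_ge (by linarith), armY_of_ge (by linarith), hd,
      min_eq_left (by nlinarith), min_eq_right (by linarith), max_eq_right (by nlinarith)]
    congr 1 <;> ring
  · have hd : (ℓ + 2) / 2 * (1 + r + t * (3 - (1 + r)) - 1) = ℓ + 2 * t := by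
      linear_combination (1 - t) * hrℓ
    have htr : 0 ≤ t * (2 - r) := mul_nonneg h0 (by linarith)
    rw [flatArm_eq_pt, lineMap_pt, armX_of_ge (by linarith), armY_of_ge (by linarith), hd,
      min_eq_right (by linarith), min_eq_right (by linarith), max_eq_left (by linarith)]
    congr 1 <;> ring

section loop

variable {c m s : ℝ}

/-- Raises the edge from `(c, 0, m)` to `(c + 1, 0, m)` by `3` above its middle third, with legs of
slope `9` at its ends. -/
def raise (c m : ℝ) : R3 → R3 :=
  push 2 fun p => 3 * (cutoff 1 (min (3 * (p 0 - c)) (3 * (c + 1 - p 0))) * cutoff 1 (1 - |p 1|)) *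
    cutoff 1 (p 2 - (m - 1))

/-- Moves the two legs of the edge raised by `raise c m` to the positions of the rising arms. -/
def swing (c m : ℝ) : R3 → R3 :=
  twist (fun h => (c + cutoff 3 (h - m) / 9 : ℝ)) (fun h => (c + 1 - cutoff 3 (h - m) / 9 : ℝ))
    (fun h => (c + 1 / 2 : ℝ) + arm 1 1 (cutoff 3 (h - m)))
    (fun h => (c + 1 / 2 : ℝ) + arm (-1) c (cutoff 3 (h - m)))

/-- Stretches the loop above the height `m` in the vertical direction, so that its arms become
rising arms. -/
def unflatten (c m : ℝ) : R3 → R3 :=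
  push 2 fun p => max (p 2 - m) 0 *
    (loopHeight 1 c (toPlane p - (c + 1 / 2 : ℝ)).re (toPlane p - (c + 1 / 2 : ℝ)).im - 1)

theorem swing_left_ne_right (c m h : ℝ) :
    ((c + cutoff 3 (h - m) / 9 : ℝ) : ℂ) ≠ (c + 1 - cutoff 3 (h - m) / 9 : ℝ) := by
  rw [Ne, Complex.ofReal_inj]
  linarith [cutoff_le zero_le_three (h - m)]

theorem swing_left_start {h : ℝ} (hh : h ≤ m) :
    ((c + cutoff 3 (h - m) / 9 : ℝ) : ℂ) = (c + 1 / 2 : ℝ) + arm 1 1 (cutoff 3 (h - m)) := by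
  rw [cutoff_of_nonpos (by linarith), arm_zero zero_le_one]
  apply Complex.ext <;> simp
  ring

theorem swing_right_start {h : ℝ} (hc : 0 ≤ c) (hh : h ≤ m) :
    ((c + 1 - cutoff 3 (h - m) / 9 : ℝ) : ℂ) =
      (c + 1 / 2 : ℝ) + arm (-1) c (cutoff 3 (h - m)) := by
  rw [cutoff_of_nonpos (by linarith), arm_zero hc]
  apply Complex.ext <;> simp
  ring

theorem ambientIsotopic_image_raise (c m : ℝ) (A : Set R3) :
    AmbientIsotopic A (raise c m '' A) := by
  refine ambientIsotopic_image_push (by fun_prop) (fun p x y hxy => ?_) A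
  have hcut := monotone_cutoff 1 (sub_le_sub_right hxy (m - 1))
  simpa using mul_le_mul_of_nonneg_left hcut
    (mul_nonneg zero_le_three (mul_nonneg (cutoff_nonneg _ _) (cutoff_nonneg _ _)))

theorem ambientIsotopic_image_swing (hc : 0 ≤ c) (hm : 0 ≤ m) (A : Set R3) :
    AmbientIsotopic A (swing c m '' A) := by
  refine ambientIsotopic_image_twist (by fun_prop) (by fun_prop) (by fun_prop) (by fun_prop)
    (swing_left_ne_right c m)
    (fun h => (add_right_injective _).ne (arm_ne_arm zero_le_one hc _))
    ?_ ?_ A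
  · exact swing_left_start hm
  · exact swing_right_start hc hm

theorem ambientIsotopic_image_unflatten (c m : ℝ) (A : Set R3) :
    AmbientIsotopic A (unflatten c m '' A) := by
  refine ambientIsotopic_image_push ?_ (fun p x y hxy => ?_) A
  · exact (by fun_prop : Continuous fun p : R3 => max (p 2 - m) 0).mul
      ((continuous_loopHeight.comp (continuous_toPlane.sub continuous_const)).sub continuous_const)
  · have hmax : max (x - m) 0 ≤ max (y - m) 0 := by gcongr
    simpa [toPlane] using mul_le_mul_of_nonneg_right hmax (sub_nonneg.2 one_le_loopHeight)

theorem raise_pt_of_mem {x : ℝ} (hx : x ∈ Set.Icc (c + 1 / 3) (c + 2 / 3)) :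
    raise c m (pt x 0 m) = pt x 0 (m + 3) := by
  rw [raise, push_two_pt]
  simp only [pt_zero, pt_one, pt_two, abs_zero, sub_zero, sub_sub_cancel]
  rw [cutoff_of_le zero_le_one (le_min (by linarith [hx.1]) (by linarith [hx.2])),
    cutoff_of_mem zero_le_one le_rfl]
  norm_num

theorem raise_pt_left (hs : s ∈ Set.Icc (0 : ℝ) 3) :
    raise c m (pt (c + s / 9) 0 m) = pt (c + s / 9) 0 (m + s) := by
  rw [raise, push_two_pt]
  simp only [pt_zero, pt_one, pt_two, abs_zero, sub_zero, sub_sub_cancel]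
  rw [min_eq_left (by linarith [hs.2]), cutoff_of_mem (by linarith [hs.1]) (by linarith [hs.2]),
    cutoff_of_mem zero_le_one le_rfl]
  congr 1
  ring

theorem raise_pt_right (hs : s ∈ Set.Icc (0 : ℝ) 3) :
    raise c m (pt (c + 1 - s / 9) 0 m) = pt (c + 1 - s / 9) 0 (m + s) := by
  rw [raise, push_two_pt]
  simp only [pt_zero, pt_one, pt_two, abs_zero, sub_zero, sub_sub_cancel]
  rw [min_eq_right (by linarith [hs.2]), cutoff_of_mem (by linarith [hs.1]) (by linarith [hs.2]),
    cutoff_of_mem zero_le_one le_rfl]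
  congr 1
  ring

theorem swing_left (hs : s ∈ Set.Icc (0 : ℝ) 3) :
    swing c m (pt (c + s / 9) 0 (m + s)) = risingArm (c + 1 / 2) m 1 1 s := by
  have h : swing c m (ofPlane _ (m + s)) = ofPlane _ (m + s) :=
    twist_left (swing_left_ne_right c m (m + s))
  rwa [add_sub_cancel_left, cutoff_of_mem hs.1 hs.2] at h

theorem swing_right (hs : s ∈ Set.Icc (0 : ℝ) 3) :
    swing c m (pt (c + 1 - s / 9) 0 (m + s)) = risingArm (c + 1 / 2) m (-1) c s := by
  have h : swing c m (ofPlane _ (m + s)) = ofPlane _ (m + s) :=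
    twist_right (swing_left_ne_right c m (m + s))
  rwa [add_sub_cancel_left, cutoff_of_mem hs.1 hs.2] at h

theorem image_swing_top :
    swing c m '' segment ℝ (pt (c + 1 / 3) 0 (m + 3)) (pt (c + 2 / 3) 0 (m + 3)) =
      segment ℝ (pt (c + 2) (-2) (m + 3)) (pt 0 (-2) (m + 3)) := by
  refine image_segment_eq_segment fun t _ => ?_
  have h : swing c m (ofPlane _ (m + 3)) = ofPlane _ (m + 3) :=
    twist_lineMap (swing_left_ne_right c m (m + 3)) t
  simp only [add_sub_cancel_left, cutoff_of_mem zero_le_three le_rfl, arm_three] at h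
  rw [lineMap_pt, lineMap_pt]
  convert h using 1
  · congr 1
    apply R3_ext <;> simp [ofPlane, AffineMap.lineMap_apply]
    ring
  · apply R3_ext <;> simp [ofPlane, AffineMap.lineMap_apply]
    ring

theorem image_swing_image_raise_segment :
    swing c m '' (raise c m '' segment ℝ (pt c 0 m) (pt (c + 1) 0 m)) =
      risingArm (c + 1 / 2) m 1 1 '' Set.Icc 0 3 ∪
        segment ℝ (pt (c + 2) (-2) (m + 3)) (pt 0 (-2) (m + 3)) ∪
        risingArm (c + 1 / 2) m (-1) c '' Set.Icc 0 3 := by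
  have hleft : segment ℝ (pt c 0 m) (pt (c + 1 / 3) 0 m) =
      (fun s => pt (c + s / 9) 0 m) '' Set.Icc 0 3 :=
    (image_Icc_eq_segment zero_le_three fun t _ => by rw [lineMap_pt]; congr 1 <;> ring).symm
  have hmid : raise c m '' segment ℝ (pt (c + 1 / 3) 0 m) (pt (c + 2 / 3) 0 m) =
      segment ℝ (pt (c + 1 / 3) 0 (m + 3)) (pt (c + 2 / 3) 0 (m + 3)) := by
    rw [segment_along_x (by linarith), segment_along_x (by linarith), Set.image_image]
    exact Set.image_congr fun x hx => raise_pt_of_mem hx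
  have hright : segment ℝ (pt (c + 2 / 3) 0 m) (pt (c + 1) 0 m) =
      (fun s => pt (c + 1 - s / 9) 0 m) '' Set.Icc 0 3 := by
    rw [segment_symm]
    exact (image_Icc_eq_segment zero_le_three fun t _ => by
      rw [lineMap_pt]; congr 1 <;> ring).symm
  have himage : ∀ {f g : ℝ → R3}, (∀ s ∈ Set.Icc (0 : ℝ) 3, swing c m (raise c m (f s)) = g s) →
      swing c m '' (raise c m '' (f '' Set.Icc 0 3)) = g '' Set.Icc 0 3 := fun h => by
    rw [Set.image_image, Set.image_image]
    exact Set.image_congr h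
  rw [← segment_along_x_union (by linarith : c ≤ c + 2 / 3) (by linarith),
    ← segment_along_x_union (by linarith : c ≤ c + 1 / 3) (by linarith), hleft, hright]
  simp only [Set.image_union, hmid, image_swing_top]
  rw [himage fun s hs => by rw [raise_pt_left hs, swing_left hs],
    himage fun s hs => by rw [raise_pt_right hs, swing_right hs]]

theorem unflatten_flatArm {σ ℓ : ℝ}
    (h : loopHeight 1 c (arm σ ℓ s).re (arm σ ℓ s).im = max s 1) (hs : 0 ≤ s) :
    unflatten c m (flatArm (c + 1 / 2) m σ ℓ s) = risingArm (c + 1 / 2) m σ ℓ s := by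
  have hmin : max (min s 1) 0 = min s 1 := max_eq_left (le_min hs zero_le_one)
  have hmul : min s 1 * max s 1 = s := by rw [min_mul_max, mul_one]
  rw [unflatten, risingArm, flatArm]
  simp only [push, toPlane_ofPlane, ofPlane_two, add_sub_cancel_left, h, hmin]
  apply R3_ext <;> simp [ofPlane]
  linarith

/-- The part that a stabilization adds to the closed braid: the crossing in the column
`c ≤ x ≤ c + 1` between the heights `m` and `m + 1`, and the rest of the strand at height
`m + 1`. -/
def loopArc (c m : ℝ) : Set R3 :=
  flatArm (c + 1 / 2) m 1 1 '' Set.Icc 0 3 ∪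
    segment ℝ (pt (c + 2) (-2) (m + 1)) (pt 0 (-2) (m + 1)) ∪
    flatArm (c + 1 / 2) m (-1) c '' Set.Icc 0 3

theorem image_unflatten_loopArc (hc : 0 ≤ c) :
    unflatten c m '' loopArc c m =
      risingArm (c + 1 / 2) m 1 1 '' Set.Icc 0 3 ∪
        segment ℝ (pt (c + 2) (-2) (m + 3)) (pt 0 (-2) (m + 3)) ∪
        risingArm (c + 1 / 2) m (-1) c '' Set.Icc 0 3 := by
  have htop : unflatten c m '' segment ℝ (pt (c + 2) (-2) (m + 1)) (pt 0 (-2) (m + 1)) =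
      segment ℝ (pt (c + 2) (-2) (m + 3)) (pt 0 (-2) (m + 3)) := by
    rw [segment_symm ℝ (pt (c + 2) _ _), segment_symm ℝ (pt (c + 2) _ _),
      segment_along_x (by linarith), segment_along_x (by linarith), Set.image_image]
    refine Set.image_congr fun x ⟨h0, h1⟩ => ?_
    rw [unflatten, push_two_pt]
    simp only [toPlane, pt_zero, pt_one, pt_two, Complex.sub_re, Complex.sub_im, Complex.ofReal_re,
      Complex.ofReal_im, sub_zero, add_sub_cancel_left]
    rw [loopHeight_neg_two zero_le_one hc (by linarith) (by linarith)]
    norm_num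
    congr 1
    ring
  have hright : unflatten c m '' (flatArm (c + 1 / 2) m 1 1 '' Set.Icc 0 3) =
      risingArm (c + 1 / 2) m 1 1 '' Set.Icc 0 3 := by
    rw [Set.image_image]
    refine Set.image_congr fun s ⟨h0, h3⟩ => unflatten_flatArm ?_ h0
    simpa [arm] using loopHeight_arm zero_le_one (by simp : |(1 : ℝ)| ≤ 1) h0 h3
  have hleft : unflatten c m '' (flatArm (c + 1 / 2) m (-1) c '' Set.Icc 0 3) =
      risingArm (c + 1 / 2) m (-1) c '' Set.Icc 0 3 := by
    rw [Set.image_image]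
    refine Set.image_congr fun s ⟨h0, h3⟩ => unflatten_flatArm ?_ h0
    rw [arm, neg_one_mul, loopHeight_neg]
    exact loopHeight_arm hc (by simp) h0 h3
  rw [loopArc, Set.image_union, Set.image_union, htop, hright, hleft]

/-- The points that stay fixed while the edge from `(c, 0, m)` to `(c + 1, 0, m)` is moved to
`loopArc c m`. -/
def loopComplement (c m : ℝ) : Set R3 :=
  {p | p 2 ≤ m ∧ (p 0 ≤ c ∨ c + 1 ≤ p 0 ∨ 1 ≤ |p 1| ∨ p 2 ≤ m - 1)}

theorem raise_eq_self {p : R3} (hp : p ∈ loopComplement c m) : raise c m p = p := by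
  refine push_eq_self ?_
  rcases hp.2 with h | h | h | h
  · rw [cutoff_of_nonpos ((min_le_left _ _).trans (by linarith))]
    simp
  · rw [cutoff_of_nonpos ((min_le_right _ _).trans (by linarith))]
    simp
  · rw [cutoff_of_nonpos (by linarith : 1 - |p 1| ≤ 0)]
    simp
  · rw [cutoff_of_nonpos (by linarith : p 2 - (m - 1) ≤ 0)]
    simp

theorem swing_eq_self {p : R3} (hc : 0 ≤ c) (hp : p 2 ≤ m) : swing c m p = p :=
  twist_eq_self (swing_left_ne_right c m) (swing_left_start hp) (swing_right_start hc hp)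

theorem unflatten_eq_self {p : R3} (hp : p 2 ≤ m) : unflatten c m p = p := by
  refine push_eq_self ?_
  rw [max_eq_right (by linarith), zero_mul]

theorem ambientIsotopic_union_loopArc (hc : 0 ≤ c) (hm : 0 ≤ m) {A : Set R3}
    (hA : A ⊆ loopComplement c m) :
    AmbientIsotopic (A ∪ segment ℝ (pt c 0 m) (pt (c + 1) 0 m)) (A ∪ loopArc c m) := by
  have hraise : raise c m '' A = A := Set.EqOn.image_eq_self fun p hp => raise_eq_self (hA hp)
  have hswing : swing c m '' A = A :=
    Set.EqOn.image_eq_self fun p hp => swing_eq_self hc (hA hp).1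
  have hunflatten : unflatten c m '' A = A :=
    Set.EqOn.image_eq_self fun p hp => unflatten_eq_self (hA hp).1
  refine ((ambientIsotopic_image_raise c m _).trans (ambientIsotopic_image_swing hc hm _)).trans ?_
  rw [Set.image_union, Set.image_union, hraise, hswing, image_swing_image_raise_segment,
    ← image_unflatten_loopArc hc]
  conv_lhs => rw [← hunflatten, ← Set.image_union]
  exact (ambientIsotopic_image_unflatten c m _).symm

theorem loopArc_eq_union_segments (hc : 0 ≤ c) :
    loopArc c m =
      (segment ℝ (pt c 0 m) (pt (c + 1 / 2) 1 (m + 1 / 2)) ∪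
        segment ℝ (pt (c + 1 / 2) 1 (m + 1 / 2)) (pt (c + 1) 0 (m + 1))) ∪
      (segment ℝ (pt (c + 1) 0 (m + 1)) (pt (c + 2) 0 (m + 1)) ∪
        segment ℝ (pt (c + 2) 0 (m + 1)) (pt (c + 2) (-2) (m + 1))) ∪
      segment ℝ (pt (c + 2) (-2) (m + 1)) (pt 0 (-2) (m + 1)) ∪
      ((segment ℝ (pt (c + 1) 0 m) (pt (c + 1 / 2) (-1) (m + 1 / 2)) ∪
        segment ℝ (pt (c + 1 / 2) (-1) (m + 1 / 2)) (pt c 0 (m + 1))) ∪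
      (segment ℝ (pt c 0 (m + 1)) (pt 0 0 (m + 1)) ∪
        segment ℝ (pt 0 0 (m + 1)) (pt 0 (-2) (m + 1)))) := by
  have himage {σ ℓ : ℝ} (hℓ : 0 ≤ ℓ) := congrArg₂ (· ∪ ·)
    (image_flatArm_crossing (x := c + 1 / 2) (m := m) (σ := σ) hℓ)
    (image_flatArm_outside (x := c + 1 / 2) (m := m) (σ := σ) hℓ)
  simp only [← Set.image_union, Set.Icc_union_Icc_eq_Icc zero_le_one
    (by norm_num : (1 : ℝ) ≤ 3)] at himage
  rw [loopArc, himage zero_le_one, himage hc]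
  ring_nf

end loop

/-! ### Stabilization -/

theorem iUnion_fin_succ {α : Type*} (f : ℕ → Set α) (m : ℕ) :
    ⋃ j : Fin (m + 1), f j = (⋃ j : Fin m, f j) ∪ f m := by
  ext p
  simp only [Set.mem_iUnion, Set.mem_union, Fin.exists_fin_succ', Fin.val_castSucc, Fin.val_last]

theorem le_of_mem_segment {p a b : R3} {i : Fin 3} {r : ℝ} (hp : p ∈ segment ℝ a b)
    (ha : a i ≤ r) (hb : b i ≤ r) : p i ≤ r :=
  (convex_halfSpace_le (LinearMap.proj (R := ℝ) (φ := fun _ => ℝ) i).isLinear r).segment_subset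
    ha hb hp

theorem ge_of_mem_segment {p a b : R3} {i : Fin 3} {r : ℝ} (hp : p ∈ segment ℝ a b)
    (ha : r ≤ a i) (hb : r ≤ b i) : r ≤ p i :=
  (convex_halfSpace_ge (LinearMap.proj (R := ℝ) (φ := fun _ => ℝ) i).isLinear r).segment_subset
    ha hb hp

/-- The union of the columns of a braid word, that is, the closed braid without its closing
arcs. -/
def columns {n : ℕ} (w : BraidWord n) : Set R3 :=
  ⋃ k : Fin w.length, crossingColumn n k (w.get k)

section columns

variable {n : ℕ} {w : BraidWord n} {p : R3}

theorem mem_columns :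
    p ∈ columns w ↔ ∃ (k : ℕ) (h : k < w.length), p ∈ crossingColumn n k w[k] := by
  simp only [columns, Set.mem_iUnion]
  exact ⟨fun ⟨k, hk⟩ => ⟨k, k.2, hk⟩, fun ⟨k, h, hk⟩ => ⟨⟨k, h⟩, hk⟩⟩

theorem columns_append_singleton (w : BraidWord n) (a : Fin (n - 1) × Bool) :
    columns (w ++ [a]) = columns w ∪ crossingColumn n w.length a := by
  ext p
  rw [Set.mem_union, mem_columns, mem_columns]
  constructor
  · rintro ⟨k, h, hp⟩
    rw [List.length_append, List.length_singleton] at h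
    rcases Nat.lt_succ_iff_lt_or_eq.1 h with h' | rfl
    · rw [List.getElem_append_left h'] at hp
      exact Or.inl ⟨k, h', hp⟩
    · rw [List.getElem_append_right le_rfl] at hp
      exact Or.inr (by simpa using hp)
  · rintro (⟨k, h, hp⟩ | hp)
    · exact ⟨k, by simp; omega, by rwa [List.getElem_append_left h]⟩
    · exact ⟨w.length, by simp, by rw [List.getElem_append_right le_rfl]; simpa using hp⟩

theorem crossingColumn_bounds {k : ℕ} {a : Fin (n - 1) × Bool} (h : p ∈ crossingColumn n k a) :
    p 0 ≤ k + 1 ∧ p 2 + 1 ≤ n := by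
  have hi : ((a.1 : ℕ) : ℝ) + 2 ≤ n := by exact_mod_cast Nat.add_lt_of_lt_sub a.1.2
  have key {x y z x' y' z' : ℝ} (hx : x ≤ k + 1) (hx' : x' ≤ k + 1) (hz : z ≤ n - 1)
      (hz' : z' ≤ n - 1) (h : p ∈ segment ℝ (pt x y z) (pt x' y' z')) :
      p 0 ≤ k + 1 ∧ p 2 + 1 ≤ n :=
    ⟨le_of_mem_segment h hx hx', le_sub_iff_add_le.1 (le_of_mem_segment h hz hz')⟩
  simp only [crossingColumn, Set.mem_union, Set.mem_iUnion, Set.mem_ofPred_eq, exists_prop] at h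
  rcases h with (⟨j, ⟨hj, -⟩, h⟩ | h | h) | h | h
  · have hj' : (j : ℝ) + 1 ≤ n := by exact_mod_cast hj
    exact key (by linarith) (by linarith) (by linarith) (by linarith) h
  all_goals exact key (by linarith) (by linarith) (by linarith) (by linarith) h

theorem columns_bounds (h : p ∈ columns w) : p 0 ≤ w.length ∧ p 2 + 1 ≤ n := by
  obtain ⟨k, hk, hp⟩ := mem_columns.1 h
  have hk' : (k : ℝ) + 1 ≤ w.length := by exact_mod_cast hk
  exact ⟨(crossingColumn_bounds hp).1.trans hk', (crossingColumn_bounds hp).2⟩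

end columns

/-- Shifts the half-space `c + 1 ≤ x` by `1` in the direction of the `x`-axis and stretches the
slab `c ≤ x ≤ c + 1`. -/
def stretch (c : ℝ) : R3 → R3 := push 0 fun p => cutoff 1 (p 0 - c)

theorem stretch_pt_of_le {c x y z : ℝ} (h : x ≤ c) : stretch c (pt x y z) = pt x y z :=
  push_eq_self (cutoff_of_nonpos (by simpa using h))

theorem stretch_pt_of_ge {c x y z : ℝ} (h : c + 1 ≤ x) :
    stretch c (pt x y z) = pt (x + 1) y z := by
  rw [stretch, push_zero_pt, pt_zero, cutoff_of_le zero_le_one (by linarith)]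

theorem ambientIsotopic_image_stretch (c : ℝ) (A : Set R3) :
    AmbientIsotopic A (stretch c '' A) := by
  refine ambientIsotopic_image_push (by fun_prop) (fun p x y hxy => ?_) A
  simpa using monotone_cutoff 1 (sub_le_sub_right hxy c)

theorem image_stretch_segment_add_one (c y z : ℝ) :
    stretch c '' segment ℝ (pt c y z) (pt (c + 1) y z) =
      segment ℝ (pt c y z) (pt (c + 2) y z) := by
  refine image_segment_eq_segment fun t ⟨h0, h1⟩ => ?_
  rw [lineMap_pt, lineMap_pt, stretch, push_zero_pt, pt_zero,
    cutoff_of_mem (by linarith) (by linarith)]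
  congr 1
  ring

theorem image_stretch_segment_zero {c : ℝ} (hc : 0 ≤ c) (y z : ℝ) :
    stretch c '' segment ℝ (pt 0 y z) (pt (c + 1) y z) =
      segment ℝ (pt 0 y z) (pt (c + 2) y z) := by
  have hleft : stretch c '' segment ℝ (pt 0 y z) (pt c y z) = segment ℝ (pt 0 y z) (pt c y z) := by
    refine Set.EqOn.image_eq_self fun p hp => push_eq_self (cutoff_of_nonpos ?_)
    exact sub_nonpos.2 (le_of_mem_segment hp hc le_rfl)
  rw [← segment_along_x_union hc (by linarith : c ≤ c + 1), Set.image_union, hleft,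
    image_stretch_segment_add_one, segment_along_x_union hc (by linarith)]

theorem image_stretch_closingArc (c j : ℕ) :
    stretch c '' closingArc c j =
      segment ℝ (pt c 0 j) (pt (c + 1) 0 j) ∪ closingArc (c + 1) j := by
  have hc : (0 : ℝ) ≤ c := c.cast_nonneg
  have hright : stretch c '' segment ℝ (pt (c + 1) 0 j) (pt (c + 1) (-2) j) =
      segment ℝ (pt (c + 2) 0 j) (pt (c + 2) (-2) j) := by
    refine image_segment_eq_segment fun t _ => ?_
    rw [lineMap_pt, lineMap_pt, stretch_pt_of_ge (by simp)]
    congr 1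
    ring
  have hleft : stretch c '' segment ℝ (pt 0 (-2) j) (pt 0 0 j) =
      segment ℝ (pt 0 (-2) j) (pt 0 0 j) := by
    refine image_segment_eq_segment fun t _ => ?_
    rw [lineMap_pt, stretch_pt_of_le (by simp)]
  have hcast : ((c + 1 : ℕ) : ℝ) + 1 = c + 2 := by push_cast; ring
  rw [closingArc, closingArc, hcast, Nat.cast_add_one, segment_symm ℝ (pt (c + 1) (-2) _),
    segment_symm ℝ (pt (c + 2) (-2) _), Set.image_union, Set.image_union, Set.image_union,
    image_stretch_segment_add_one, hright, image_stretch_segment_zero hc, hleft,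
    ← segment_along_x_union (by linarith : (c : ℝ) ≤ c + 1) (by linarith)]
  simp only [Set.union_assoc]

/-- The column `k ≤ x ≤ k + 1` of a braid in which `n` strands are straight. -/
def straightColumn (n k : ℕ) : Set R3 :=
  ⋃ j : Fin n, segment ℝ (pt k 0 (j : ℕ)) (pt (k + 1) 0 (j : ℕ))

section stabilize

variable {m : ℕ}

/-- The part of the stabilized closed braid that is already present before the stabilization. -/
def stabilizationRest (w : BraidWord (m + 1)) : Set R3 :=
  columns w ∪ straightColumn m w.length ∪ ⋃ j : Fin (m + 1), closingArc (w.length + 1) j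

theorem image_stretch_closedBraid (w : BraidWord (m + 1)) :
    stretch w.length '' closedBraid w =
      stabilizationRest w ∪ segment ℝ (pt w.length 0 m) (pt (w.length + 1) 0 m) := by
  have hcolumns : stretch w.length '' columns w = columns w :=
    Set.EqOn.image_eq_self fun p hp =>
      push_eq_self (cutoff_of_nonpos (sub_nonpos.2 (columns_bounds hp).1))
  have hclosed : closedBraid w = columns w ∪ ⋃ j : Fin (m + 1), closingArc w.length j := rfl
  rw [hclosed, Set.image_union, hcolumns, Set.image_iUnion]
  simp only [image_stretch_closingArc]
  rw [Set.iUnion_union_distrib, stabilizationRest, straightColumn,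
    iUnion_fin_succ fun j => segment ℝ (pt w.length 0 j) (pt (w.length + 1) 0 j),
    Set.union_right_comm, ← Set.union_assoc, ← Set.union_assoc]

/-- The Markov stabilization of a braid word. -/
def stabilize (w : BraidWord (m + 1)) : BraidWord (m + 2) :=
  (w.map fun a => ((Fin.castSucc (n := m) a.1 : Fin (m + 1)), a.2)) ++ [(Fin.last m, true)]

theorem length_stabilize (w : BraidWord (m + 1)) : (stabilize w).length = w.length + 1 := by
  simp [stabilize]

theorem crossingColumn_castSucc {k : ℕ} (a : Fin (m + 1 - 1) × Bool) :
    crossingColumn (m + 2) k ((Fin.castSucc (n := m) a.1 : Fin (m + 1)), a.2) =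
      crossingColumn (m + 1) k a ∪ segment ℝ (pt k 0 (m + 1)) (pt (k + 1) 0 (m + 1)) := by
  have hi : (a.1 : ℕ) < m := a.1.2
  have hindices : {j : ℕ | j < m + 2 ∧ j ≠ (a.1 : ℕ) ∧ j ≠ (a.1 : ℕ) + 1} =
      insert (m + 1) {j : ℕ | j < m + 1 ∧ j ≠ (a.1 : ℕ) ∧ j ≠ (a.1 : ℕ) + 1} := by
    ext j
    simp only [Set.mem_insert_iff, Set.mem_ofPred_eq]
    omega
  simp only [crossingColumn, Fin.val_castSucc]
  rw [hindices, Set.biUnion_insert, Set.union_comm (segment _ _ _), Nat.cast_add_one,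
    Set.union_right_comm _ (segment ℝ (pt k 0 (m + 1)) _),
    Set.union_right_comm _ (segment ℝ (pt k 0 (m + 1)) _)]

theorem columns_map_castSucc (w : BraidWord (m + 1)) :
    columns (n := m + 2) (w.map fun a => ((Fin.castSucc (n := m) a.1 : Fin (m + 1)), a.2)) ∪
        {pt 0 0 (m + 1)} =
      columns w ∪ segment ℝ (pt 0 0 (m + 1)) (pt w.length 0 (m + 1)) := by
  induction w using List.reverseRecOn with
  | nil =>
    have hnil {n : ℕ} : columns ([] : BraidWord n) = ∅ := by
      ext p
      simp [mem_columns]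
    rw [List.map_nil, hnil, hnil]
    simp
  | append_singleton w a ih =>
    rw [List.map_append, List.map_singleton, columns_append_singleton, columns_append_singleton,
      Set.union_right_comm, ih, crossingColumn_castSucc, List.length_map, List.length_append,
      List.length_singleton, Nat.cast_add, Nat.cast_one,
      ← segment_along_x_union (Nat.cast_nonneg w.length : (0 : ℝ) ≤ w.length)
        (by linarith : (w.length : ℝ) ≤ w.length + 1), Set.union_union_union_comm]

theorem crossingColumn_last (k : ℕ) :
    crossingColumn (m + 2) k (Fin.last m, true) = straightColumn m k ∪
      (segment ℝ (pt k 0 m) (pt (k + 1 / 2) 1 (m + 1 / 2)) ∪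
        segment ℝ (pt (k + 1 / 2) 1 (m + 1 / 2)) (pt (k + 1) 0 (m + 1))) ∪
      (segment ℝ (pt k 0 (m + 1)) (pt (k + 1 / 2) (-1) (m + 1 / 2)) ∪
        segment ℝ (pt (k + 1 / 2) (-1) (m + 1 / 2)) (pt (k + 1) 0 m)) := by
  have hstraight : (⋃ j ∈ {j : ℕ | j < m + 2 ∧ j ≠ m ∧ j ≠ m + 1},
      segment ℝ (pt k 0 j) (pt (k + 1) 0 j)) = straightColumn m k := by
    ext p
    simp only [straightColumn, Set.mem_iUnion, Set.mem_ofPred_eq, exists_prop, Fin.exists_iff]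
    refine exists_congr fun j => and_congr_left fun _ => ?_
    omega
  simp only [crossingColumn, Fin.val_last, hstraight, if_true]

theorem closedBraid_stabilize (w : BraidWord (m + 1)) :
    closedBraid (stabilize w) = stabilizationRest w ∪ loopArc w.length m := by
  have hclosed : closedBraid (stabilize w) = columns (stabilize w) ∪
      ⋃ j : Fin (m + 2), closingArc (stabilize w).length j := rfl
  have hstart : closingArc (w.length + 1) (m + 1) ∪ {pt 0 0 (m + 1)} =
      closingArc (w.length + 1) (m + 1) := by
    rw [Set.union_eq_left, Set.singleton_subset_iff]
    exact Or.inr (by simpa using right_mem_segment ℝ (pt 0 (-2) (m + 1)) (pt 0 0 (m + 1)))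
  have hlength : (w.length : ℝ) + 1 + 1 = w.length + 2 := by ring
  rw [hclosed, length_stabilize, iUnion_fin_succ fun j => closingArc (w.length + 1) j, ← hstart,
    stabilize, columns_append_singleton, List.length_map, crossingColumn_last,
    loopArc_eq_union_segments (Nat.cast_nonneg _)]
  ext p
  have hcolumns := Set.ext_iff.1 (columns_map_castSucc w) p
  simp only [stabilizationRest, closingArc, Nat.cast_add_one, hlength, Set.mem_union,
    segment_symm ℝ (pt (w.length + 1) 0 m),
    segment_symm ℝ (pt (w.length + 1 / 2) (-1) _) (pt w.length _ _),
    segment_symm ℝ (pt w.length 0 (m + 1)) (pt 0 _ _), segment_symm ℝ (pt 0 0 _) (pt 0 (-2) _)]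
    at hcolumns ⊢
  tauto

theorem stabilizationRest_subset_loopComplement (w : BraidWord (m + 1)) :
    stabilizationRest w ⊆ loopComplement w.length m := by
  rintro p ((hp | hp) | hp)
  · obtain ⟨h0, h2⟩ := columns_bounds hp
    push_cast at h2
    exact ⟨by linarith, Or.inl h0⟩
  · obtain ⟨j, hp⟩ := Set.mem_iUnion.1 hp
    have hj : ((j : ℕ) : ℝ) + 1 ≤ m := by exact_mod_cast j.2
    have h2 : p 2 ≤ (j : ℕ) := le_of_mem_segment hp le_rfl le_rfl
    exact ⟨by linarith, Or.inr (Or.inr (Or.inr (by linarith)))⟩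
  · obtain ⟨j, hp⟩ := Set.mem_iUnion.1 hp
    have hj : ((j : ℕ) : ℝ) ≤ m := by exact_mod_cast Nat.lt_succ_iff.1 j.2
    rw [closingArc, Nat.cast_add_one] at hp
    rcases hp with ((hp | hp) | hp) | hp
    all_goals refine ⟨(le_of_mem_segment hp le_rfl le_rfl).trans hj, ?_⟩
    · exact Or.inr (Or.inl (ge_of_mem_segment hp (by simp) (by simp)))
    · exact Or.inr (Or.inl (ge_of_mem_segment hp (by simp) (by simp)))
    · have h1 : p 1 ≤ -2 := le_of_mem_segment hp le_rfl le_rfl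
      exact Or.inr (Or.inr (Or.inl (by linarith [neg_le_abs (p 1)])))
    · exact Or.inl (le_of_mem_segment hp (by simp) (by simp))

theorem ambientIsotopic_stabilize (w : BraidWord (m + 1)) :
    AmbientIsotopic (closedBraid w) (closedBraid (stabilize w)) := by
  rw [closedBraid_stabilize]
  refine .trans ?_ (ambientIsotopic_union_loopArc (Nat.cast_nonneg _) (Nat.cast_nonneg _)
    (stabilizationRest_subset_loopComplement w))
  rw [← image_stretch_closedBraid]
  exact ambientIsotopic_image_stretch _ _

end stabilize

/-! ### Simplices meeting in a common face -/

section MeetInFace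

variable {E : Type*} [AddCommGroup E] [Module ℝ E] {s t : Set E}

theorem mem_convexHull_sep_of_forall_le {f : E →ₗ[ℝ] ℝ} {d : ℝ} (hs : ∀ q ∈ s, f q ≤ d) {p : E}
    (hp : p ∈ convexHull ℝ s) (hfp : f p = d) : p ∈ convexHull ℝ {q ∈ s | f q = d} := by
  classical
  rw [convexHull_eq] at hp
  obtain ⟨ι, t, w, z, hw, hw1, hz, rfl⟩ := hp
  have weighted_gap : ∑ i ∈ t, w i * (d - f (z i)) = 0 := by
    rw [Finset.centerMass_eq_of_sum_1 _ _ hw1, map_sum] at hfp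
    simp only [map_smul, smul_eq_mul] at hfp
    simp only [mul_sub, Finset.sum_sub_distrib, ← Finset.sum_mul, hw1, hfp]
    ring
  rw [Finset.sum_eq_zero_iff_of_nonneg fun i hi =>
    mul_nonneg (hw i hi) (sub_nonneg.2 (hs _ (hz i hi)))] at weighted_gap
  rw [← Finset.centerMass_filter_ne_zero]
  refine Finset.centerMass_mem_convexHull _ (fun i hi => hw i (Finset.mem_filter.1 hi).1) ?_ ?_
  · rw [Finset.sum_filter_ne_zero, hw1]
    exact zero_lt_one
  · intro i hi
    obtain ⟨hi, hi0⟩ := Finset.mem_filter.1 hi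
    have gap := (mul_eq_zero.1 (weighted_gap i hi)).resolve_left hi0
    exact ⟨hz i hi, by linarith⟩

/-- The simplices with vertex sets `s` and `t` meet in the face spanned by their common
vertices, as any two simplices of a simplicial complex have to. -/
def MeetInFace (s t : Set E) : Prop := convexHull ℝ s ∩ convexHull ℝ t ⊆ convexHull ℝ (s ∩ t)

namespace MeetInFace

theorem symm (h : MeetInFace s t) : MeetInFace t s := by
  rwa [MeetInFace, Set.inter_comm, Set.inter_comm t]

theorem of_subset (h : s ⊆ t) : MeetInFace s t := by
  rw [MeetInFace, Set.inter_eq_left.2 h]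
  exact Set.inter_subset_left

theorem of_subsingleton (hs : s.Subsingleton) (ht : t.Subsingleton) : MeetInFace s t := by
  rw [MeetInFace, hs.convex.convexHull_eq, ht.convex.convexHull_eq]
  exact subset_convexHull ℝ _

theorem of_subset_left {u : Set E} (h : MeetInFace s t) (hfin : s.Finite)
    (hs : AffineIndependent ℝ ((↑) : s → E)) (hus : u ⊆ s) : MeetInFace u t := by
  lift s to Finset E using hfin
  lift u to Finset E using s.finite_toSet.subset hus
  classical
  obtain ⟨r, hr⟩ : ∃ r : Finset E, (r : Set E) = (s : Set E) ∩ t :=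
    ⟨_, (s.finite_toSet.inter_of_left t).coe_toFinset⟩
  have hrs : r ⊆ s := fun p hp => (hr.subset hp).1
  rintro p ⟨hpu, hpt⟩
  have hpr : p ∈ convexHull ℝ (r : Set E) := hr ▸ h ⟨convexHull_mono hus hpu, hpt⟩
  have hp : p ∈ convexHull ℝ (u ∩ r : Set E) := by
    rw [AffineIndependent.convexHull_inter hs hus hrs]
    exact ⟨hpu, hpr⟩
  exact convexHull_mono (Set.inter_subset_inter_right _ (hr.subset.trans Set.inter_subset_right)) hp

theorem of_separated (f : E →ₗ[ℝ] ℝ) (d : ℝ) (hs : ∀ q ∈ s, f q ≤ d) (ht : ∀ q ∈ t, d ≤ f q)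
    (h : MeetInFace {q ∈ s | f q = d} {q ∈ t | f q = d}) : MeetInFace s t := by
  rintro p ⟨hps, hpt⟩
  have hfp : f p = d := le_antisymm
    (convexHull_min (t := {q | f q ≤ d}) hs (convex_halfSpace_le f.isLinear d) hps)
    (convexHull_min (t := {q | d ≤ f q}) ht (convex_halfSpace_ge f.isLinear d) hpt)
  have hps' := mem_convexHull_sep_of_forall_le hs hps hfp
  have hpt' := mem_convexHull_sep_of_forall_le (f := -f) (d := -d)
    (fun q hq => neg_le_neg (ht q hq)) hpt (by simp [hfp])
  simp only [LinearMap.neg_apply, neg_inj] at hpt'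
  exact convexHull_mono (Set.inter_subset_inter (Set.sep_subset _ _) (Set.sep_subset _ _))
    (h ⟨hps', hpt'⟩)

theorem of_supporting (f : E →ₗ[ℝ] ℝ) (d : ℝ) (hs : ∀ q ∈ s, f q ≤ d) (ht : ∀ q ∈ t, d ≤ f q)
    (h : ∀ q ∈ s, f q = d → q ∈ t) : MeetInFace s t :=
  of_separated f d hs ht <| of_subset <| by
    rintro q ⟨hq, hqd⟩
    exact ⟨h q hq hqd, hqd⟩

theorem of_lt (f : E →ₗ[ℝ] ℝ) (d : ℝ) (hs : ∀ q ∈ s, f q < d) (ht : ∀ q ∈ t, d ≤ f q) :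
    MeetInFace s t :=
  of_supporting f d (fun q hq => (hs q hq).le) ht fun q hq hqd => absurd hqd (hs q hq).ne

theorem of_mem_hyperplane (f : E →ₗ[ℝ] ℝ) (d : ℝ) (hs : ∀ q ∈ s, f q ≤ d)
    (ht : ∀ q ∈ t, f q = d) (h : MeetInFace {q ∈ s | f q = d} t) : MeetInFace s t :=
  of_separated f d hs (fun q hq => (ht q hq).ge) <| by rwa [Set.sep_eq_self_iff_mem_true.2 ht]

end MeetInFace

end MeetInFace

theorem affineIndependent_of_mul_sub_mul_ne_zero {E : Type*} [AddCommGroup E] [Module ℝ E]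
    (f g : E →ₗ[ℝ] ℝ) {v : Fin 3 → E}
    (h : f (v 1 - v 0) * g (v 2 - v 0) - f (v 2 - v 0) * g (v 1 - v 0) ≠ 0) :
    AffineIndependent ℝ v := by
  rw [affineIndependent_iff_of_fintype]
  intro w hw hw'
  rw [Finset.weightedVSub_eq_weightedVSubOfPoint_of_sum_eq_zero _ _ _ hw (v 0),
    Finset.weightedVSubOfPoint_apply] at hw'
  simp only [Fin.sum_univ_three, vsub_eq_sub, sub_self, smul_zero, zero_add] at hw hw'
  have hf := congrArg f hw'
  have hg := congrArg g hw'
  rw [map_add, map_smul, map_smul, map_zero, smul_eq_mul, smul_eq_mul] at hf hg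
  have h1 : w 1 = 0 := (mul_eq_zero_iff_right h).1 <| by
    linear_combination g (v 2 - v 0) * hf - f (v 2 - v 0) * hg
  have h2 : w 2 = 0 := (mul_eq_zero_iff_right h).1 <| by
    linear_combination f (v 1 - v 0) * hg - g (v 1 - v 0) * hf
  rw [Fin.forall_fin_succ, Fin.forall_fin_two]
  exact ⟨by linarith, h1, h2⟩

/-! ### Oriented families of triangles -/

theorem eq_add_one_or_eq_add_one_of_ne :
    ∀ {s t : Fin 3}, s ≠ t → t = s + 1 ∨ s = t + 1 := by decide

/-- A family of triangles with cyclically ordered vertices that fit together to an oriented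
simplicial surface, possibly with boundary: a directed edge belongs to at most one triangle. -/
structure OrientedTriangles (ι : Type*) where
  v : ι → Fin 3 → R3
  indep : ∀ τ, AffineIndependent ℝ (v τ)
  meetInFace : ∀ τ τ', MeetInFace (Set.range (v τ)) (Set.range (v τ'))
  range_injective : Function.Injective fun τ => Set.range (v τ)
  directed : ∀ {τ τ' s s'}, v τ s = v τ' s' → v τ (s + 1) = v τ' (s' + 1) → τ = τ'

namespace OrientedTriangles

variable {ι : Type*}

open Classical in
/-- The vertex set of a triangle. -/
def tri (D : OrientedTriangles ι) (τ : ι) : Finset R3 := Finset.univ.image (D.v τ)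

/-- The directed edge from `a` to `b` occurs in the triangle `τ`. -/
def HasEdge (D : OrientedTriangles ι) (τ : ι) (a b : R3) : Prop :=
  ∃ s, D.v τ s = a ∧ D.v τ (s + 1) = b

/-- A directed edge whose reverse does not occur. -/
def IsBoundaryEdge (D : OrientedTriangles ι) (a b : R3) : Prop :=
  (∃ τ, D.HasEdge τ a b) ∧ ∀ τ, ¬ D.HasEdge τ b a

variable {D : OrientedTriangles ι} {τ τ' : ι} {a b : R3}

theorem coe_tri : (D.tri τ : Set R3) = Set.range (D.v τ) := by simp [tri]

theorem mem_tri : a ∈ D.tri τ ↔ ∃ s, D.v τ s = a := by simp [tri]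

theorem v_injective : Function.Injective (D.v τ) := (D.indep τ).injective

theorem card_tri : (D.tri τ).card = 3 := by
  classical
  rw [tri, Finset.card_image_of_injective _ v_injective, Finset.card_univ, Fintype.card_fin]

theorem tri_injective : Function.Injective D.tri := fun τ τ' h =>
  D.range_injective <| show Set.range _ = Set.range _ by rw [← coe_tri, ← coe_tri, h]

theorem indep_tri : AffineIndependent ℝ ((↑) : ↑(D.tri τ : Set R3) → R3) := by
  rw [coe_tri]
  exact (D.indep τ).range

namespace HasEdge

theorem unique (h : D.HasEdge τ a b) (h' : D.HasEdge τ' a b) : τ = τ' := by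
  obtain ⟨s, rfl, rfl⟩ := h
  obtain ⟨s', ha, hb⟩ := h'
  exact (D.directed ha hb).symm

theorem not_reverse (h : D.HasEdge τ a b) : ¬ D.HasEdge τ b a := by
  obtain ⟨s, rfl, rfl⟩ := h
  rintro ⟨s', h1, h2⟩
  obtain rfl := v_injective h1
  have add_two_ne : ∀ r : Fin 3, r + 1 + 1 ≠ r := by decide
  exact add_two_ne s (v_injective h2)

theorem left_mem (h : D.HasEdge τ a b) : a ∈ D.tri τ :=
  mem_tri.2 (h.imp fun _ hs => hs.1)

theorem right_mem (h : D.HasEdge τ a b) : b ∈ D.tri τ :=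
  mem_tri.2 (h.elim fun _ hs => ⟨_, hs.2⟩)

theorem ne (h : D.HasEdge τ a b) : a ≠ b := by
  obtain ⟨s, rfl, rfl⟩ := h
  exact v_injective.ne (by decide +revert)

end HasEdge

theorem hasEdge_v_iff {s t : Fin 3} : D.HasEdge τ (D.v τ s) (D.v τ t) ↔ t = s + 1 := by
  constructor
  · rintro ⟨r, hs, ht⟩
    rw [← v_injective hs, ← v_injective ht]
  · rintro rfl
    exact ⟨s, rfl, rfl⟩

theorem hasEdge_or_hasEdge (ha : a ∈ D.tri τ) (hb : b ∈ D.tri τ) (hab : a ≠ b) :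
    D.HasEdge τ a b ∨ D.HasEdge τ b a := by
  obtain ⟨s, rfl⟩ := mem_tri.1 ha
  obtain ⟨t, rfl⟩ := mem_tri.1 hb
  rw [hasEdge_v_iff, hasEdge_v_iff]
  exact eq_add_one_or_eq_add_one_of_ne (ne_of_apply_ne _ hab)

/-- The simplicial complex formed by the triangles and their faces. -/
def complex (D : OrientedTriangles ι) : Geometry.SimplicialComplex ℝ R3 where
  faces := {s | s.Nonempty ∧ ∃ τ, s ⊆ D.tri τ}
  isRelLowerSet_faces := by
    rintro s ⟨hs, τ, h⟩
    exact ⟨hs, fun t hts ht => ⟨ht, τ, hts.trans h⟩⟩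
  indep := by
    rintro s ⟨-, τ, h⟩
    exact indep_tri.mono (t := (D.tri τ : Set R3)) h
  inter_subset_convexHull := by
    rintro s t ⟨-, τ, hs⟩ ⟨-, τ', ht⟩
    have h : MeetInFace (D.tri τ : Set R3) (D.tri τ') := by
      rw [coe_tri, coe_tri]
      exact D.meetInFace τ τ'
    have hst' := h.of_subset_left (D.tri τ).finite_toSet indep_tri hs
    exact (hst'.symm.of_subset_left (D.tri τ').finite_toSet indep_tri ht).symm

theorem tri_mem_simplices (τ : ι) : D.tri τ ∈ simplices D.complex 2 :=
  ⟨⟨Finset.card_pos.1 (by rw [card_tri]; norm_num), τ, subset_rfl⟩, card_tri⟩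

theorem simplices_two : simplices D.complex 2 = Set.range D.tri := by
  ext t
  constructor
  · rintro ⟨⟨-, τ, h⟩, hc⟩
    exact ⟨τ, (Finset.eq_of_subset_of_card_le h (by rw [card_tri, hc])).symm⟩
  · rintro ⟨τ, rfl⟩
    exact tri_mem_simplices τ

open Classical in
theorem HasEdge.mem_simplices (h : D.HasEdge τ a b) : {a, b} ∈ simplices D.complex 1 :=
  ⟨⟨by simp, τ, Finset.insert_subset h.left_mem (Finset.singleton_subset_iff.2 h.right_mem)⟩,
    Finset.card_pair h.ne⟩

open Classical in
theorem mem_simplices_one {e : Finset R3} :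
    e ∈ simplices D.complex 1 ↔ ∃ τ a b, D.HasEdge τ a b ∧ e = {a, b} := by
  constructor
  · rintro ⟨⟨-, τ, h⟩, hc⟩
    obtain ⟨a, b, hab, rfl⟩ := Finset.card_eq_two.1 hc
    rcases hasEdge_or_hasEdge (h (by simp)) (h (by simp)) hab with hE | hE
    · exact ⟨τ, a, b, hE, rfl⟩
    · exact ⟨τ, b, a, hE, Finset.pair_comm a b⟩
  · rintro ⟨τ, a, b, h, rfl⟩
    exact h.mem_simplices

theorem mem_simplices_zero {e : Finset R3} :
    e ∈ simplices D.complex 0 ↔ ∃ τ s, e = {D.v τ s} := by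
  constructor
  · rintro ⟨⟨-, τ, h⟩, hc⟩
    obtain ⟨a, rfl⟩ := Finset.card_eq_one.1 hc
    obtain ⟨s, rfl⟩ := mem_tri.1 (Finset.singleton_subset_iff.1 h)
    exact ⟨τ, s, rfl⟩
  · rintro ⟨τ, s, rfl⟩
    exact ⟨⟨by simp, τ, Finset.singleton_subset_iff.2 (mem_tri.2 ⟨s, rfl⟩)⟩,
      Finset.card_singleton _⟩

open Classical in
theorem trianglesAt_pair (hab : a ≠ b) :
    trianglesAt D.complex {a, b} = D.tri '' {τ | D.HasEdge τ a b ∨ D.HasEdge τ b a} := by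
  ext t
  rw [trianglesAt, Set.mem_ofPred_eq, simplices_two]
  constructor
  · rintro ⟨⟨τ, rfl⟩, hs⟩
    exact ⟨τ, hasEdge_or_hasEdge (hs (by simp)) (hs (by simp)) hab, rfl⟩
  · rintro ⟨τ, h | h, rfl⟩
    · exact ⟨⟨τ, rfl⟩, Finset.insert_subset h.left_mem (Finset.singleton_subset_iff.2 h.right_mem)⟩
    · exact ⟨⟨τ, rfl⟩, Finset.insert_subset h.right_mem (Finset.singleton_subset_iff.2 h.left_mem)⟩

open Classical in
theorem ncard_trianglesAt_of_reverse (h : D.HasEdge τ a b) (h' : D.HasEdge τ' b a) :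
    (trianglesAt D.complex {a, b}).ncard = 2 := by
  have hne : τ ≠ τ' := by rintro rfl; exact h.not_reverse h'
  have hpair : {σ | D.HasEdge σ a b ∨ D.HasEdge σ b a} = {τ, τ'} := by
    ext σ
    refine ⟨Or.imp (fun hσ => hσ.unique h) fun hσ => hσ.unique h', ?_⟩
    rintro (rfl | rfl)
    exacts [Or.inl h, Or.inr h']
  rw [trianglesAt_pair h.ne, hpair, Set.ncard_image_of_injective _ tri_injective,
    Set.ncard_pair hne]

open Classical in
theorem IsBoundaryEdge.ncard_trianglesAt (h : D.IsBoundaryEdge a b) :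
    (trianglesAt D.complex {a, b}).ncard = 1 := by
  obtain ⟨⟨τ, h⟩, h'⟩ := h
  have hsingle : {σ | D.HasEdge σ a b ∨ D.HasEdge σ b a} = {τ} := by
    ext σ
    refine ⟨fun hσ => (hσ.resolve_right (h' σ)).unique h, ?_⟩
    rintro rfl
    exact Or.inl h
  rw [trianglesAt_pair h.ne, hsingle, Set.image_singleton, Set.ncard_singleton]

theorem ncard_trianglesAt_eq_one_or_two {e : Finset R3} (he : e ∈ simplices D.complex 1) :
    (trianglesAt D.complex e).ncard = 1 ∨ (trianglesAt D.complex e).ncard = 2 := by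
  classical
  obtain ⟨τ, a, b, h, rfl⟩ := mem_simplices_one.1 he
  by_cases h' : ∃ τ', D.HasEdge τ' b a
  · exact Or.inr (ncard_trianglesAt_of_reverse h h'.choose_spec)
  · exact Or.inl (IsBoundaryEdge.ncard_trianglesAt ⟨⟨τ, h⟩, not_exists.1 h'⟩)

theorem mem_boundary_complex {p : R3} :
    p ∈ boundary D.complex ↔ ∃ a b, D.IsBoundaryEdge a b ∧ p ∈ segment ℝ a b := by
  classical
  simp only [boundary, Set.mem_iUnion, exists_prop, ← convexHull_pair, ← Finset.coe_pair]
  constructor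
  · rintro ⟨e, ⟨he, hn⟩, hp⟩
    obtain ⟨τ, a, b, h, rfl⟩ := mem_simplices_one.1 he
    refine ⟨a, b, ⟨⟨τ, h⟩, fun τ' h' => ?_⟩, hp⟩
    rw [ncard_trianglesAt_of_reverse h h'] at hn
    norm_num at hn
  · rintro ⟨a, b, h, hp⟩
    exact ⟨{a, b}, ⟨h.1.choose_spec.mem_simplices, h.ncard_trianglesAt⟩, hp⟩

theorem hasEdge_rotate {c : R3} (ha : a ∈ D.tri τ) (hb : b ∈ D.tri τ) (hc : c ∈ D.tri τ)
    (hab : a ≠ b) (hbc : b ≠ c) (hac : a ≠ c) : D.HasEdge τ a b ↔ D.HasEdge τ b c := by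
  obtain ⟨i, rfl⟩ := mem_tri.1 ha
  obtain ⟨j, rfl⟩ := mem_tri.1 hb
  obtain ⟨k, rfl⟩ := mem_tri.1 hc
  have rotate : ∀ i j k : Fin 3, i ≠ j → j ≠ k → i ≠ k → (j = i + 1 ↔ k = j + 1) := by decide
  rw [hasEdge_v_iff, hasEdge_v_iff]
  exact rotate i j k (ne_of_apply_ne _ hab) (ne_of_apply_ne _ hbc) (ne_of_apply_ne _ hac)

theorem isOrientable : IsOrientable D.complex := by
  have edge_of_tri : ∀ {τ a b}, (∃ τ', D.tri τ' = D.tri τ ∧ D.HasEdge τ' a b) ↔ D.HasEdge τ a b :=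
    ⟨fun ⟨τ', h, h'⟩ => tri_injective h ▸ h', fun h => ⟨_, rfl, h⟩⟩
  refine ⟨fun t a b => ∃ τ, D.tri τ = t ∧ D.HasEdge τ a b, ?_, ?_⟩ <;> rw [simplices_two]
  · rintro _ ⟨τ, rfl⟩ a ha b hb c hc hab hbc hac
    simp only [edge_of_tri]
    exact ⟨hasEdge_rotate ha hb hc hab hbc hac,
      HasEdge.not_reverse, (hasEdge_or_hasEdge ha hb hab).resolve_right⟩
  · rintro _ ⟨τ, rfl⟩ _ ⟨τ', rfl⟩ hne a b hab ha hb ha' hb'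
    simp only [edge_of_tri]
    have hne' : τ ≠ τ' := ne_of_apply_ne _ hne
    exact ⟨fun h => (hasEdge_or_hasEdge ha' hb' hab).resolve_left fun h' => hne' (h.unique h'),
      fun h => (hasEdge_or_hasEdge ha hb hab).resolve_right fun h' => hne' (h'.unique h)⟩

theorem finite_faces [Finite ι] : D.complex.faces.Finite := by
  refine (Set.finite_iUnion fun τ => (D.tri τ).powerset.finite_toSet).subset ?_
  rintro s ⟨-, τ, h⟩
  exact Set.mem_iUnion.2 ⟨τ, by simpa using h⟩

theorem exists_triangle_of_mem_faces {s : Finset R3} (hs : s ∈ D.complex.faces) :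
    ∃ t ∈ simplices D.complex 2, s ⊆ t := by
  obtain ⟨-, τ, h⟩ := hs
  exact ⟨_, tri_mem_simplices τ, h⟩

theorem space_complex : D.complex.space = ⋃ τ, convexHull ℝ (Set.range (D.v τ)) := by
  ext p
  simp only [Geometry.SimplicialComplex.mem_space_iff, Set.mem_iUnion, ← coe_tri]
  constructor
  · rintro ⟨s, ⟨-, τ, h⟩, hp⟩
    exact ⟨τ, convexHull_mono (Finset.coe_subset.2 h) hp⟩
  · rintro ⟨τ, hp⟩
    exact ⟨_, (tri_mem_simplices τ).1, hp⟩

end OrientedTriangles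

/-! ### The Seifert surface of a closed braid -/

/-- The crossings of a braid word with `c` letters on `n` strands: the `k`-th letter interchanges
the strands at the heights `i k` and `i k + 1`, and its sign is `ε k`. -/
structure Crossings where
  n : ℕ
  c : ℕ
  i : ℕ → ℕ
  ε : ℕ → ℝ
  i_lt : ∀ k < c, i k + 1 < n
  ε_sq : ∀ k, ε k * ε k = 1

/-- The vertices of the Seifert surface. It has one disk at every height `j`, a fan of triangles
with the common vertex `apex j` over the edges from `rim j k` to `rim j (k + 1)`. The vertices
`rising k` and `falling k` are the midpoints of the two strands at the `k`-th crossing; they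
belong to the band that joins two disks there. -/
inductive Vertex
  | rim (j k : ℕ)
  | apex (j : ℕ)
  | rising (k : ℕ)
  | falling (k : ℕ)

open Vertex

namespace Crossings

variable (X : Crossings)

/-- The `x`-coordinate of the `k`-th vertex on the rim of a disk. -/
def rimX (k : ℕ) : ℝ := (min k (X.c + 1) : ℕ)

/-- The `y`-coordinate of the `k`-th vertex on the rim of a disk. The truncated subtraction makes
it vanish up to `k = c + 1`, and the last vertex of the rim has `k = c + 2`. -/
def rimY (k : ℕ) : ℝ := -2 * (k - (X.c + 1) : ℕ)

/-- The position of a vertex. -/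
def pos : Vertex → R3
  | rim j k => pt (X.rimX k) (X.rimY k) j
  | apex j => pt 0 (-2) j
  | rising k => pt (k + 1 / 2) (X.ε k) (X.i k + 1 / 2)
  | falling k => pt (k + 1 / 2) (-X.ε k) (X.i k + 1 / 2)

/-- The triangles of the surface: those of the disks, and four for every crossing. -/
abbrev Triangle : Type := (Fin X.n × Fin (X.c + 2)) ⊕ (Fin X.c × Fin 4)

/-- The vertices of a triangle, in cyclic order. -/
def label : X.Triangle → Fin 3 → Vertex
  | Sum.inl (j, k) => ![apex j, rim j k, rim j (k + 1)]
  | Sum.inr (k, 0) => ![rim (X.i k) k, rising k, falling k]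
  | Sum.inr (k, 1) => ![rim (X.i k) (k + 1), rim (X.i k) k, falling k]
  | Sum.inr (k, 2) => ![rising k, rim (X.i k + 1) (k + 1), falling k]
  | Sum.inr (k, 3) => ![rim (X.i k + 1) (k + 1), rim (X.i k + 1) k, falling k]

/-- The positions of the vertices of a triangle. -/
def vert (τ : X.Triangle) (s : Fin 3) : R3 := X.pos (X.label τ s)

/-- The cross product of the vectors from the apex of a disk to the `k`-th and the `l`-th vertex
of its rim. -/
def cross (k l : ℕ) : ℝ := X.rimX k * (X.rimY l + 2) - X.rimX l * (X.rimY k + 2)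

variable {X}

theorem rimX_of_le {k : ℕ} (h : k ≤ X.c + 1) : X.rimX k = k := by rw [rimX, min_eq_left h]

theorem rimY_of_le {k : ℕ} (h : k ≤ X.c + 1) : X.rimY k = 0 := by
  rw [rimY, Nat.sub_eq_zero_of_le h, Nat.cast_zero, mul_zero]

theorem rimX_last : X.rimX (X.c + 2) = X.c + 1 := by
  rw [rimX, min_eq_right (by omega)]
  push_cast
  rfl

theorem rimY_last : X.rimY (X.c + 2) = -2 := by
  rw [rimY, Nat.add_sub_add_left, Nat.cast_one, mul_one]

theorem pos_rim {j k : ℕ} (h : k ≤ X.c + 1) : X.pos (rim j k) = pt k 0 j := by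
  rw [pos, rimX_of_le h, rimY_of_le h]

theorem pos_rim_succ {j k : ℕ} (h : k ≤ X.c) : X.pos (rim j (k + 1)) = pt (k + 1) 0 j := by
  rw [pos_rim (Nat.succ_le_succ h), Nat.cast_succ]

theorem pos_rim_last {j : ℕ} : X.pos (rim j (X.c + 2)) = pt (X.c + 1) (-2) j := by
  rw [pos, rimX_last, rimY_last]

theorem ε_ne_zero (k : ℕ) : X.ε k ≠ 0 := left_ne_zero_of_mul_eq_one (X.ε_sq k)

theorem cross_self (k : ℕ) : X.cross k k = 0 := sub_self _

theorem cross_swap (k l : ℕ) : X.cross k l = -X.cross l k := (neg_sub _ _).symm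

theorem cross_neg {k l : ℕ} (h : k < l) (hl : l ≤ X.c + 2) : X.cross k l < 0 := by
  have hkl : (k : ℝ) < l := Nat.cast_lt.2 h
  rw [cross, rimX_of_le (by omega : k ≤ X.c + 1), rimY_of_le (by omega : k ≤ X.c + 1)]
  rcases hl.lt_or_eq with hl | rfl
  · rw [rimX_of_le (by omega), rimY_of_le (by omega)]
    linarith
  · rw [rimX_last, rimY_last]
    linarith [X.c.cast_nonneg (α := ℝ)]

theorem cross_nonpos {k l : ℕ} (h : k ≤ l) (hl : l ≤ X.c + 2) : X.cross k l ≤ 0 := by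
  rcases h.lt_or_eq with h | rfl
  · exact (cross_neg h hl).le
  · exact (cross_self k).le

theorem cross_nonneg {k l : ℕ} (h : l ≤ k) (hk : k ≤ X.c + 2) : 0 ≤ X.cross k l := by
  rw [cross_swap]
  exact neg_nonneg.2 (cross_nonpos h hk)

/-- Twice the `x`-coordinate of a vertex, a natural number. -/
def doubleX (X : Crossings) : Vertex → ℕ
  | rim _ k => 2 * min k (X.c + 1)
  | apex _ => 0
  | rising k => 2 * k + 1
  | falling k => 2 * k + 1

theorem doubleX_eq (u : Vertex) : (X.doubleX u : ℝ) = 2 * X.pos u 0 := by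
  cases u <;> simp only [doubleX, pos, rimX, pt_zero] <;> push_cast <;> ring

theorem pos_rim_ne_apex (j k l : ℕ) : X.pos (rim j k) ≠ X.pos (apex l) := by
  intro h
  have hx : X.rimX k = 0 := congrFun h 0
  have hy : X.rimY k = -2 := congrFun h 1
  have hk : k ≤ X.c + 1 := by
    rw [rimX, Nat.cast_eq_zero] at hx
    omega
  rw [rimY_of_le hk] at hy
  norm_num at hy

theorem pos_rising_ne_falling (k : ℕ) : X.pos (rising k) ≠ X.pos (falling k) := by
  intro h
  have hy : X.ε k = -X.ε k := congrFun h 1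
  exact ε_ne_zero k (self_eq_neg.1 hy)

theorem pos_rim_inj {j k j' k' : ℕ} (h : X.pos (rim j k) = X.pos (rim j' k')) :
    j = j' ∧ k = k' := by
  have hx : X.rimX k = X.rimX k' := congrFun h 0
  have hy : X.rimY k = X.rimY k' := congrFun h 1
  have hz : (j : ℝ) = j' := congrFun h 2
  rw [rimX, rimX, Nat.cast_inj] at hx
  rw [rimY, rimY, mul_right_inj' (by norm_num), Nat.cast_inj] at hy
  exact ⟨Nat.cast_injective hz, by omega⟩

theorem pos_injective : Function.Injective X.pos := by
  intro u u' h
  have hx : X.doubleX u = X.doubleX u' := by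
    rw [← Nat.cast_inj (R := ℝ), doubleX_eq, doubleX_eq, h]
  have hz : X.pos u 2 = X.pos u' 2 := congrFun h 2
  cases u <;> cases u' <;> simp only [doubleX] at hx <;> try omega
  case rim.rim => rw [(pos_rim_inj h).1, (pos_rim_inj h).2]
  case rim.apex => exact absurd h (pos_rim_ne_apex _ _ _)
  case apex.rim => exact absurd h.symm (pos_rim_ne_apex _ _ _)
  case apex.apex => rw [Nat.cast_injective (R := ℝ) hz]
  case rising.rising k k' => rw [show k = k' by omega]
  case falling.falling k k' => rw [show k = k' by omega]
  case rising.falling k k' =>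
    obtain rfl : k = k' := by omega
    exact absurd h (pos_rising_ne_falling k)
  case falling.rising k k' =>
    obtain rfl : k = k' := by omega
    exact absurd h.symm (pos_rising_ne_falling k)

theorem label_directed {τ τ' : X.Triangle} {s s' : Fin 3} (h : X.label τ s = X.label τ' s')
    (h' : X.label τ (s + 1) = X.label τ' (s' + 1)) : τ = τ' := by
  rcases τ with ⟨j, k⟩ | ⟨k, x⟩ <;> rcases τ' with ⟨j', k'⟩ | ⟨k', x'⟩
  · fin_cases s <;> fin_cases s' <;> simp [label] at h h' ⊢ <;> grind
  · fin_cases x' <;> fin_cases s <;> fin_cases s' <;> simp [label] at h h' ⊢ <;> grind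
  · fin_cases x <;> fin_cases s <;> fin_cases s' <;> simp [label] at h h' ⊢ <;> grind
  · fin_cases x <;> fin_cases x' <;> fin_cases s <;> fin_cases s' <;>
      simp [label] at h h' ⊢ <;> grind

theorem range_label_injective : Function.Injective fun τ => Set.range (X.label τ) := by
  intro τ τ' h
  have hsub : ∀ s, ∃ s', X.label τ' s' = X.label τ s := fun s => h.subset (Set.mem_range_self s)
  simp only [Fin.forall_fin_succ, Fin.exists_fin_succ] at hsub
  rcases τ with ⟨j, k⟩ | ⟨k, x⟩ <;> rcases τ' with ⟨j', k'⟩ | ⟨k', x'⟩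
  · simp [label] at hsub ⊢; grind
  · fin_cases x' <;> simp [label] at hsub ⊢
  · fin_cases x <;> simp [label] at hsub ⊢
  · fin_cases x <;> fin_cases x' <;> simp [label] at hsub ⊢ <;> grind

theorem forall_mem_range_vert {τ : X.Triangle} {P : R3 → Prop} :
    (∀ q ∈ Set.range (X.vert τ), P q) ↔
      P (X.pos (X.label τ 0)) ∧ P (X.pos (X.label τ 1)) ∧ P (X.pos (X.label τ 2)) := by
  rw [Set.forall_mem_range, Fin.forall_fin_succ, Fin.forall_fin_two]
  rfl

theorem affineIndependent_vert (τ : X.Triangle) : AffineIndependent ℝ (X.vert τ) := by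
  refine affineIndependent_of_mul_sub_mul_ne_zero
    (LinearMap.proj (R := ℝ) (φ := fun _ => ℝ) 0) (LinearMap.proj (R := ℝ) (φ := fun _ => ℝ) 1) ?_
  intro h
  simp only [LinearMap.coe_proj, Pi.sub_apply, vert] at h
  rcases τ with ⟨j, k⟩ | ⟨k, x⟩
  · refine (cross_neg (X := X) (k : ℕ).lt_succ_self (by omega)).ne ?_
    simp only [label, Matrix.cons_val, pos, pt_zero, pt_one] at h
    rw [cross]
    linarith
  · have : (k : ℕ) ≤ X.c := k.2.le
    have hX : X.rimX k = (k : ℕ) := rimX_of_le (by omega)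
    have hX' : X.rimX (k + 1) = (k : ℕ) + 1 := by rw [rimX_of_le (by omega), Nat.cast_succ]
    have hY : X.rimY k = 0 := rimY_of_le (by omega)
    have hY' : X.rimY (k + 1) = 0 := rimY_of_le (by omega)
    refine ε_ne_zero (X := X) k ?_
    fin_cases x <;>
      simp only [label, Matrix.cons_val, pos, pt_zero, pt_one, hX, hX', hY, hY'] at h <;> linarith

/-- A linear functional that is constant on the line from an apex through the midpoint of the
`a`-th and the `b`-th vertex of the rim: with `a = k + 1`, the line separates the `k`-th triangle
of a disk from the `b`-th one. -/
def sideForm (X : Crossings) (a b : ℕ) : R3 →ₗ[ℝ] ℝ :=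
  (X.rimY a + 2 + (X.rimY b + 2)) • LinearMap.proj 0 - (X.rimX a + X.rimX b) • LinearMap.proj 1

/-- The value of `sideForm` on its separating line. -/
def apexSide (X : Crossings) (a b : ℕ) : ℝ := 2 * (X.rimX a + X.rimX b)

theorem sideForm_apex (a b j : ℕ) : X.sideForm a b (X.pos (apex j)) = X.apexSide a b := by
  simp only [sideForm, apexSide, LinearMap.sub_apply, LinearMap.smul_apply, LinearMap.coe_proj,
    smul_eq_mul, pos, pt_zero, pt_one]
  ring

theorem sideForm_rim (a b j k : ℕ) :
    X.sideForm a b (X.pos (rim j k)) = X.apexSide a b + (X.cross k a + X.cross k b) := by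
  simp only [sideForm, apexSide, LinearMap.sub_apply, LinearMap.smul_apply, LinearMap.coe_proj,
    smul_eq_mul, pos, pt_zero, pt_one, cross]
  ring

theorem sideForm_rim_le {a b k : ℕ} (j : ℕ) (hka : k ≤ a) (hkb : k ≤ b) (ha : a ≤ X.c + 2)
    (hb : b ≤ X.c + 2) : X.sideForm a b (X.pos (rim j k)) ≤ X.apexSide a b := by
  rw [sideForm_rim]
  linarith [cross_nonpos (X := X) hka ha, cross_nonpos (X := X) hkb hb]

theorem le_sideForm_rim {a b k : ℕ} (j : ℕ) (hak : a ≤ k) (hbk : b ≤ k) (hk : k ≤ X.c + 2) :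
    X.apexSide a b ≤ X.sideForm a b (X.pos (rim j k)) := by
  rw [sideForm_rim]
  linarith [cross_nonneg (X := X) hak hk, cross_nonneg (X := X) hbk hk]

theorem eq_of_sideForm_rim_eq {a b j k : ℕ} (hka : k ≤ a) (hab : a ≤ b) (hb : b ≤ X.c + 2)
    (h : X.sideForm a b (X.pos (rim j k)) = X.apexSide a b) : k = b := by
  rw [sideForm_rim] at h
  by_contra hne
  linarith [cross_nonpos (X := X) hka (hab.trans hb),
    cross_neg (X := X) (lt_of_le_of_ne (hka.trans hab) hne) hb]

theorem meetInFace_disk_of_lt {j : Fin X.n} {k k' : Fin (X.c + 2)} (h : k < k') :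
    MeetInFace (Set.range (X.vert (Sum.inl (j, k)))) (Set.range (X.vert (Sum.inl (j, k')))) := by
  have : (k : ℕ) < k' := h
  have := k'.2
  refine MeetInFace.of_supporting (X.sideForm (k + 1) k') (X.apexSide (k + 1) k') ?_ ?_ ?_ <;>
    rw [forall_mem_range_vert]
  · exact ⟨(sideForm_apex _ _ _).le, sideForm_rim_le _ (by omega) (by omega) (by omega) (by omega),
      sideForm_rim_le _ (by omega) (by omega) (by omega) (by omega)⟩
  · exact ⟨(sideForm_apex _ _ _).ge, le_sideForm_rim _ (by omega) (by omega) (by omega),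
      le_sideForm_rim _ (by omega) (by omega) (by omega)⟩
  · refine ⟨fun _ => ⟨0, rfl⟩, fun e => ?_, fun e => ⟨1, ?_⟩⟩
    · have := eq_of_sideForm_rim_eq (by omega) (by omega) (by omega) e
      omega
    · have hkk' := eq_of_sideForm_rim_eq (by omega) (by omega) (by omega) e
      change X.pos (rim j k') = X.pos (rim j (k + 1))
      rw [hkk']

theorem height_disk (j : Fin X.n) (k : Fin (X.c + 2)) :
    ∀ q ∈ Set.range (X.vert (Sum.inl (j, k))), q 2 = (j : ℕ) :=
  forall_mem_range_vert.2 ⟨rfl, rfl, rfl⟩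

theorem meetInFace_disk (j : Fin X.n) (k k' : Fin (X.c + 2)) :
    MeetInFace (Set.range (X.vert (Sum.inl (j, k)))) (Set.range (X.vert (Sum.inl (j, k')))) := by
  rcases lt_trichotomy k k' with h | rfl | h
  · exact meetInFace_disk_of_lt h
  · exact MeetInFace.of_subset subset_rfl
  · exact (meetInFace_disk_of_lt h).symm

theorem meetInFace_of_height_lt {s t : Set R3} {d : ℝ} (hs : ∀ q ∈ s, q 2 < d)
    (ht : ∀ q ∈ t, d ≤ q 2) : MeetInFace s t :=
  .of_lt (LinearMap.proj 2) d hs ht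

theorem meetInFace_disk_disk (j j' : Fin X.n) (k k' : Fin (X.c + 2)) :
    MeetInFace (Set.range (X.vert (Sum.inl (j, k)))) (Set.range (X.vert (Sum.inl (j', k')))) := by
  have of_lt : ∀ {j j' : Fin X.n} {k k' : Fin (X.c + 2)}, j < j' →
      MeetInFace (Set.range (X.vert (Sum.inl (j, k)))) (Set.range (X.vert (Sum.inl (j', k')))) :=
    fun h => meetInFace_of_height_lt
      (fun q hq => (height_disk _ _ q hq).trans_lt (Nat.cast_lt.2 h))
      (fun q hq => (height_disk _ _ q hq).ge)
  rcases lt_trichotomy j j' with h | rfl | h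
  · exact of_lt h
  · exact meetInFace_disk j k k'
  · exact (of_lt h).symm

theorem meetInFace_of_touching {t : Set R3} {σ : ℝ} {k : ℕ} (hk : k < X.c) (j : Fin X.n)
    (ht : ∀ q ∈ t, q = X.pos (rim j k) ∨ q = X.pos (rim j (k + 1)) ∨ 0 < σ * (q 2 - (j : ℕ)))
    (k' : Fin (X.c + 2)) : MeetInFace t (Set.range (X.vert (Sum.inl (j, k')))) := by
  refine MeetInFace.of_mem_hyperplane (-σ • LinearMap.proj 2) (-σ * (j : ℕ)) ?_ ?_ ?_
  · intro q hq
    change -σ * q 2 ≤ _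
    rcases ht q hq with rfl | rfl | h
    · exact le_rfl
    · exact le_rfl
    · linarith
  · intro q hq
    change -σ * q 2 = _
    rw [height_disk j k' q hq]
  let τ : X.Triangle := Sum.inl (j, ⟨k, by omega⟩)
  refine (meetInFace_disk j ⟨k, by omega⟩ k').of_subset_left (Set.finite_range _)
    (affineIndependent_vert τ).range ?_
  rintro q ⟨hq, hqd : -σ * q 2 = -σ * (j : ℕ)⟩
  rcases ht q hq with rfl | rfl | h
  · exact ⟨1, rfl⟩
  · exact ⟨2, rfl⟩
  · linarith

theorem meetInFace_of_level {t : Set R3} {m k : ℕ} (hk : k < X.c) {σ : ℝ} (hσ : σ * σ = 1)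
    (ht : ∀ q ∈ t, q = X.pos (rim m k) ∨ q = X.pos (rim m (k + 1)) ∨ q 2 = m + σ / 2)
    (j : Fin X.n) (k' : Fin (X.c + 2)) :
    MeetInFace t (Set.range (X.vert (Sum.inl (j, k')))) := by
  have height : ∀ q ∈ t, q 2 = m ∨ q 2 = m + σ / 2 := by
    intro q hq
    rcases ht q hq with rfl | rfl | h
    exacts [Or.inl rfl, Or.inl rfl, Or.inr h]
  have hσ' := abs_le_of_sq_le_sq' (a := σ) (b := 1) (by linarith) zero_le_one
  rcases lt_trichotomy m j with h | rfl | h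
  · have h : (m : ℝ) + 1 ≤ (j : ℕ) := by exact_mod_cast h
    refine meetInFace_of_height_lt (d := (j : ℕ)) (fun q hq => ?_)
      fun q hq => (height_disk j k' q hq).ge
    rcases height q hq with h | h <;> linarith
  · refine meetInFace_of_touching (σ := σ) hk j (fun q hq => ?_) k'
    refine (ht q hq).imp_right (Or.imp_right fun h => ?_)
    rw [h]
    linarith
  · have h : ((j : ℕ) : ℝ) + 1 ≤ m := by exact_mod_cast h
    refine (meetInFace_of_height_lt (d := (j : ℕ) + 1 / 2)
      (fun q hq => (height_disk j k' q hq).trans_lt (by linarith)) fun q hq => ?_).symm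
    rcases height q hq with h | h <;> linarith

theorem vert_lower (k : Fin X.c) {x : Fin 4} (hx : x = 0 ∨ x = 1) :
    ∀ q ∈ Set.range (X.vert (Sum.inr (k, x))), q = X.pos (rim (X.i k) k) ∨
      q = X.pos (rim (X.i k) (k + 1)) ∨ q 2 = (X.i k : ℕ) + 1 / 2 := by
  rw [forall_mem_range_vert]
  rcases hx with rfl | rfl
  · exact ⟨Or.inl rfl, Or.inr (Or.inr rfl), Or.inr (Or.inr rfl)⟩
  · exact ⟨Or.inr (Or.inl rfl), Or.inl rfl, Or.inr (Or.inr rfl)⟩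

theorem vert_upper (k : Fin X.c) {x : Fin 4} (hx : x = 2 ∨ x = 3) :
    ∀ q ∈ Set.range (X.vert (Sum.inr (k, x))), q = X.pos (rim (X.i k + 1) k) ∨
      q = X.pos (rim (X.i k + 1) (k + 1)) ∨ q 2 = (X.i k : ℕ) + 1 / 2 := by
  rw [forall_mem_range_vert]
  rcases hx with rfl | rfl
  · exact ⟨Or.inr (Or.inr rfl), Or.inr (Or.inl rfl), Or.inr (Or.inr rfl)⟩
  · exact ⟨Or.inr (Or.inl rfl), Or.inl rfl, Or.inr (Or.inr rfl)⟩

theorem lower_or_upper : ∀ x : Fin 4, (x = 0 ∨ x = 1) ∨ (x = 2 ∨ x = 3) := by decide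

theorem meetInFace_band_disk (k : Fin X.c) (x : Fin 4) (j : Fin X.n) (k' : Fin (X.c + 2)) :
    MeetInFace (Set.range (X.vert (Sum.inr (k, x)))) (Set.range (X.vert (Sum.inl (j, k')))) := by
  rcases lower_or_upper x with hx | hx
  · exact meetInFace_of_level k.2 (σ := 1) (by norm_num) (vert_lower k hx) j k'
  · refine meetInFace_of_level k.2 (m := X.i k + 1) (σ := -1) (by norm_num) (fun q hq => ?_) j k'
    refine (vert_upper k hx q hq).imp_right (Or.imp_right fun h => ?_)
    rw [h]
    push_cast
    ring

theorem subsingleton_band_inter_wall (k : Fin X.c) (x : Fin 4) (m : ℕ) :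
    {q ∈ Set.range (X.vert (Sum.inr (k, x))) | q 0 = m}.Subsingleton := by
  have doubleX_eq_of_wall : ∀ s, X.vert (Sum.inr (k, x)) s 0 = m →
      X.doubleX (X.label (Sum.inr (k, x)) s) = 2 * m := by
    intro s hs
    rw [← Nat.cast_inj (R := ℝ), doubleX_eq]
    push_cast
    rw [← hs, vert]
  rintro _ ⟨⟨s, rfl⟩, hs⟩ _ ⟨⟨s', rfl⟩, hs'⟩
  congr 1
  have hs := doubleX_eq_of_wall s hs
  have hs' := doubleX_eq_of_wall s' hs'
  have hk := k.2
  fin_cases x <;> fin_cases s <;> fin_cases s' <;> simp [label, doubleX] at hs hs' ⊢ <;> omega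

theorem band_bounds (k : Fin X.c) (x : Fin 4) :
    ∀ q ∈ Set.range (X.vert (Sum.inr (k, x))), q 0 ∈ Set.Icc (k : ℝ) ((k + 1 : ℕ) : ℝ) := by
  rintro _ ⟨s, rfl⟩
  have hk := k.2
  obtain ⟨hl, hu⟩ : 2 * k ≤ X.doubleX (X.label (Sum.inr (k, x)) s) ∧
      X.doubleX (X.label (Sum.inr (k, x)) s) ≤ 2 * (k + 1) := by
    fin_cases x <;> fin_cases s <;> simp [label, doubleX] <;> omega
  rw [← Nat.cast_le (α := ℝ), doubleX_eq, Nat.cast_mul, Nat.cast_two] at hl hu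
  exact ⟨le_of_mul_le_mul_left hl two_pos, le_of_mul_le_mul_left hu two_pos⟩

theorem meetInFace_band_of_lt {k k' : Fin X.c} (h : k < k') (x x' : Fin 4) :
    MeetInFace (Set.range (X.vert (Sum.inr (k, x)))) (Set.range (X.vert (Sum.inr (k', x')))) := by
  have hkk' : ((k + 1 : ℕ) : ℝ) ≤ (k' : ℕ) := Nat.cast_le.2 h
  exact MeetInFace.of_separated (LinearMap.proj 0) (k + 1 : ℕ)
    (fun q hq => (band_bounds k x q hq).2) (fun q hq => hkk'.trans (band_bounds k' x' q hq).1)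
    (.of_subsingleton (subsingleton_band_inter_wall k x (k + 1))
      (subsingleton_band_inter_wall k' x' (k + 1)))

theorem meetInFace_band_lower (k : Fin X.c) :
    MeetInFace (Set.range (X.vert (Sum.inr (k, 0)))) (Set.range (X.vert (Sum.inr (k, 1)))) := by
  have hε := X.ε_sq k
  refine MeetInFace.of_supporting
    (LinearMap.proj 0 - X.ε k • LinearMap.proj 1 - (3 : ℝ) • LinearMap.proj 2)
    (k + 3 / 2 - 3 * (X.i k + 1 / 2)) ?_ ?_ ?_ <;>
    rw [forall_mem_range_vert] <;>
    simp only [label, Matrix.cons_val, LinearMap.sub_apply, LinearMap.smul_apply,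
      LinearMap.coe_proj, smul_eq_mul]
  · rw [pos_rim (by omega)]
    simp only [pos, pt_zero, pt_one, pt_two]
    refine ⟨?_, ?_, ?_⟩ <;> linarith
  · rw [pos_rim_succ k.2.le, pos_rim (by omega)]
    simp only [pos, pt_zero, pt_one, pt_two]
    refine ⟨?_, ?_, ?_⟩ <;> linarith
  · refine ⟨fun _ => ⟨1, rfl⟩, fun e => ?_, fun _ => ⟨2, rfl⟩⟩
    simp only [pos, pt_zero, pt_one, pt_two] at e
    linarith

theorem meetInFace_band_upper (k : Fin X.c) :
    MeetInFace (Set.range (X.vert (Sum.inr (k, 2)))) (Set.range (X.vert (Sum.inr (k, 3)))) := by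
  have hε := X.ε_sq k
  refine MeetInFace.of_supporting
    ((3 : ℝ) • LinearMap.proj 2 - LinearMap.proj 0 - X.ε k • LinearMap.proj 1)
    (3 * (X.i k + 1 / 2) + 1 / 2 - k) ?_ ?_ ?_ <;>
    rw [forall_mem_range_vert] <;>
    simp only [label, Matrix.cons_val, LinearMap.sub_apply, LinearMap.smul_apply,
      LinearMap.coe_proj, smul_eq_mul]
  · rw [pos_rim_succ k.2.le]
    simp only [pos, pt_zero, pt_one, pt_two, Nat.cast_succ]
    refine ⟨?_, ?_, ?_⟩ <;> linarith
  · rw [pos_rim_succ k.2.le, pos_rim (by omega)]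
    simp only [pos, pt_zero, pt_one, pt_two, Nat.cast_succ]
    refine ⟨?_, ?_, ?_⟩ <;> linarith
  · refine ⟨fun e => ?_, fun _ => ⟨0, rfl⟩, fun _ => ⟨2, rfl⟩⟩
    simp only [pos, pt_zero, pt_one, pt_two] at e
    linarith

theorem meetInFace_band_lower_upper (k : Fin X.c) {x x' : Fin 4} (hx : x = 0 ∨ x = 1)
    (hx' : x' = 2 ∨ x' = 3) :
    MeetInFace (Set.range (X.vert (Sum.inr (k, x)))) (Set.range (X.vert (Sum.inr (k, x')))) := by
  have lower_le : ∀ q ∈ Set.range (X.vert (Sum.inr (k, x))), q 2 ≤ (X.i k : ℝ) + 1 / 2 := by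
    intro q hq
    rcases vert_lower k hx q hq with rfl | rfl | h
    · exact le_add_of_nonneg_right (by norm_num)
    · exact le_add_of_nonneg_right (by norm_num)
    · exact h.le
  have le_upper : ∀ q ∈ Set.range (X.vert (Sum.inr (k, x'))), (X.i k : ℝ) + 1 / 2 ≤ q 2 := by
    have height_disk_above : (X.i k : ℝ) + 1 / 2 ≤ (X.i k + 1 : ℕ) := by push_cast; linarith
    intro q hq
    rcases vert_upper k hx' q hq with rfl | rfl | h
    exacts [height_disk_above, height_disk_above, h.ge]
  rcases hx' with rfl | rfl
  · refine MeetInFace.of_supporting (LinearMap.proj 2) _ lower_le le_upper ?_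
    rw [forall_mem_range_vert]
    rcases hx with rfl | rfl
    · exact ⟨fun e => by simp [label, pos] at e, fun _ => ⟨0, rfl⟩, fun _ => ⟨2, rfl⟩⟩
    · exact ⟨fun e => by simp [label, pos] at e, fun e => by simp [label, pos] at e,
        fun _ => ⟨2, rfl⟩⟩
  · refine (MeetInFace.of_supporting (-LinearMap.proj 2) (-(X.i k + 1 / 2))
      (fun q hq => neg_le_neg (le_upper q hq)) (fun q hq => neg_le_neg (lower_le q hq)) ?_).symm
    rw [forall_mem_range_vert]
    refine ⟨fun e => ?_, fun e => ?_, fun _ => ⟨2, ?_⟩⟩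
    · norm_num [label, pos] at e
    · norm_num [label, pos] at e
    · rcases hx with rfl | rfl <;> rfl

theorem meetInFace_band_self (k : Fin X.c) (x x' : Fin 4) :
    MeetInFace (Set.range (X.vert (Sum.inr (k, x)))) (Set.range (X.vert (Sum.inr (k, x')))) := by
  rcases lower_or_upper x with hx | hx <;> rcases lower_or_upper x' with hx' | hx'
  · rcases hx with rfl | rfl <;> rcases hx' with rfl | rfl
    exacts [.of_subset subset_rfl, meetInFace_band_lower k, (meetInFace_band_lower k).symm,
      .of_subset subset_rfl]
  · exact meetInFace_band_lower_upper k hx hx'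
  · exact (meetInFace_band_lower_upper k hx' hx).symm
  · rcases hx with rfl | rfl <;> rcases hx' with rfl | rfl
    exacts [.of_subset subset_rfl, meetInFace_band_upper k, (meetInFace_band_upper k).symm,
      .of_subset subset_rfl]

theorem meetInFace_vert (τ τ' : X.Triangle) :
    MeetInFace (Set.range (X.vert τ)) (Set.range (X.vert τ')) := by
  rcases τ with ⟨j, k⟩ | ⟨k, x⟩ <;> rcases τ' with ⟨j', k'⟩ | ⟨k', x'⟩
  · exact meetInFace_disk_disk j j' k k'
  · exact (meetInFace_band_disk k' x' j k).symm
  · exact meetInFace_band_disk k x j' k'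
  · rcases lt_trichotomy k k' with h | rfl | h
    · exact meetInFace_band_of_lt h x x'
    · exact meetInFace_band_self k x x'
    · exact (meetInFace_band_of_lt h x' x).symm

theorem range_vert (τ : X.Triangle) : Set.range (X.vert τ) = X.pos '' Set.range (X.label τ) :=
  Set.range_comp X.pos (X.label τ)

/-- The Seifert surface of a closed braid: a stack of disks joined by half-twisted bands. -/
def surface (X : Crossings) : OrientedTriangles X.Triangle where
  v := X.vert
  indep := affineIndependent_vert
  meetInFace := meetInFace_vert
  range_injective τ τ' h := by
    simp only [range_vert] at h
    exact range_label_injective (pos_injective.image_injective h)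
  directed h h' := label_directed (pos_injective h) (pos_injective h')

end Crossings

/-! ### The boundary of the Seifert surface -/

namespace OrientedTriangles

variable {ι : Type*} {D : OrientedTriangles ι}

theorem HasEdge.exists_common_vertex {τ τ' : ι} {a b a' b' p : R3} (h : D.HasEdge τ a b)
    (h' : D.HasEdge τ' a' b') (hp : p ∈ segment ℝ a b) (hp' : p ∈ segment ℝ a' b') :
    ∃ q, (q = a ∨ q = b) ∧ (q = a' ∨ q = b') := by
  classical
  rw [← convexHull_pair, ← Finset.coe_pair] at hp hp'
  have hp'' := D.complex.inter_subset_convexHull h.mem_simplices.1 h'.mem_simplices.1 ⟨hp, hp'⟩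
  obtain ⟨q, hq, hq'⟩ := convexHull_nonempty_iff.1 ⟨p, hp''⟩
  rw [Finset.coe_pair] at hq hq'
  exact ⟨q, hq, hq'⟩

/-- The union of the boundary edges with an initial vertex that satisfies `P`. -/
def boundaryPart (D : OrientedTriangles ι) (P : R3 → Prop) : Set R3 :=
  {p | ∃ a b, D.IsBoundaryEdge a b ∧ P a ∧ p ∈ segment ℝ a b}

theorem isClosed_boundaryPart [Finite ι] (P : R3 → Prop) : IsClosed (D.boundaryPart P) := by
  have eq_biUnion : D.boundaryPart P =
      ⋃ e ∈ {e : R3 × R3 | D.IsBoundaryEdge e.1 e.2 ∧ P e.1}, segment ℝ e.1 e.2 := by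
    ext p
    simp only [boundaryPart, Set.mem_ofPred_eq, Set.mem_iUnion, exists_prop, Prod.exists,
      and_assoc]
  have hfin : {e : R3 × R3 | D.IsBoundaryEdge e.1 e.2 ∧ P e.1}.Finite := by
    refine (Set.finite_range fun x : ι × Fin 3 => (D.v x.1 x.2, D.v x.1 (x.2 + 1))).subset ?_
    rintro ⟨_, _⟩ ⟨⟨⟨τ, s, rfl, rfl⟩, -⟩, -⟩
    exact ⟨(τ, s), rfl⟩
  rw [eq_biUnion]
  refine hfin.isClosed_biUnion fun e _ => ?_
  rw [← convexHull_pair]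
  exact (Set.toFinite _).isClosed_convexHull ℝ

theorem disjoint_boundaryPart {P : R3 → Prop} (hP : ∀ a b, D.IsBoundaryEdge a b → (P a ↔ P b)) :
    Disjoint (D.boundaryPart P) (D.boundaryPart fun a => ¬P a) := by
  rw [Set.disjoint_left]
  rintro p ⟨a, b, hab, ha, hp⟩ ⟨a', b', hab', ha', hp'⟩
  obtain ⟨⟨τ, h⟩, -⟩ := id hab
  obtain ⟨⟨τ', h'⟩, -⟩ := id hab'
  obtain ⟨q, hq, hq'⟩ := h.exists_common_vertex h' hp hp'
  have pos : P q := by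
    rcases hq with rfl | rfl
    exacts [ha, (hP _ _ hab).1 ha]
  have neg : ¬P q := by
    rcases hq' with rfl | rfl
    exacts [ha', fun h => ha' ((hP _ _ hab').2 h)]
  exact neg pos

theorem forall_of_isPreconnected_boundary [Finite ι] (hD : IsPreconnected (boundary D.complex))
    {P : R3 → Prop} (hP : ∀ a b, D.IsBoundaryEdge a b → (P a ↔ P b)) {a b a' b' : R3}
    (h : D.IsBoundaryEdge a b) (h' : D.IsBoundaryEdge a' b') (ha : P a) : P a' := by
  by_contra ha'
  have mem_boundary : ∀ {a b}, D.IsBoundaryEdge a b → a ∈ boundary D.complex := fun {a b} h =>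
    mem_boundary_complex.2 ⟨a, b, h, left_mem_segment ℝ a b⟩
  obtain ⟨p, -, hp⟩ := isPreconnected_closed_iff.1 hD _ _ (D.isClosed_boundaryPart P)
    (D.isClosed_boundaryPart fun a => ¬P a)
    (fun p hp => by
      obtain ⟨a, b, hab, hp⟩ := mem_boundary_complex.1 hp
      by_cases ha : P a
      exacts [Or.inl ⟨a, b, hab, ha, hp⟩, Or.inr ⟨a, b, hab, ha, hp⟩])
    ⟨a, mem_boundary h, a, b, h, ha, left_mem_segment ℝ a b⟩
    ⟨a', mem_boundary h', a', b', h', ha', left_mem_segment ℝ a' b'⟩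
  exact Set.disjoint_left.1 (disjoint_boundaryPart hP) hp.1 hp.2

end OrientedTriangles

namespace Crossings

variable {X : Crossings}

/-- A directed edge of the oriented triangles. -/
def DirEdge (X : Crossings) (a b : Vertex) : Prop := ∃ τ s, X.label τ s = a ∧ X.label τ (s + 1) = b

/-- The directed edges on the boundary. -/
inductive BoundaryEdge (X : Crossings) : Vertex → Vertex → Prop
  | apex_rim {j} (hj : j < X.n) : X.BoundaryEdge (apex j) (rim j 0)
  | rim_rim {j k} (hj : j < X.n) (hk : k < X.c + 2)
      (h : k < X.c → j ≠ X.i k ∧ j ≠ X.i k + 1) : X.BoundaryEdge (rim j k) (rim j (k + 1))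
  | rim_apex {j} (hj : j < X.n) : X.BoundaryEdge (rim j (X.c + 2)) (apex j)
  | rim_rising {k} (hk : k < X.c) : X.BoundaryEdge (rim (X.i k) k) (rising k)
  | rising_rim {k} (hk : k < X.c) : X.BoundaryEdge (rising k) (rim (X.i k + 1) (k + 1))
  | rim_falling {k} (hk : k < X.c) : X.BoundaryEdge (rim (X.i k + 1) k) (falling k)
  | falling_rim {k} (hk : k < X.c) : X.BoundaryEdge (falling k) (rim (X.i k) (k + 1))

theorem DirEdge.fan {j k : ℕ} (hj : j < X.n) (hk : k < X.c + 2) :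
    X.DirEdge (apex j) (rim j k) ∧ X.DirEdge (rim j k) (rim j (k + 1)) ∧
      X.DirEdge (rim j (k + 1)) (apex j) :=
  ⟨⟨Sum.inl (⟨j, hj⟩, ⟨k, hk⟩), 0, rfl, rfl⟩, ⟨Sum.inl (⟨j, hj⟩, ⟨k, hk⟩), 1, rfl, rfl⟩,
    ⟨Sum.inl (⟨j, hj⟩, ⟨k, hk⟩), 2, rfl, rfl⟩⟩

theorem BoundaryEdge.dirEdge {a b : Vertex} (h : X.BoundaryEdge a b) : X.DirEdge a b := by
  cases h with
  | apex_rim hj => exact (DirEdge.fan hj (Nat.succ_pos _)).1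
  | rim_rim hj hk => exact (DirEdge.fan hj hk).2.1
  | rim_apex hj => exact (DirEdge.fan hj (Nat.lt_succ_self _)).2.2
  | rim_rising hk => exact ⟨Sum.inr (⟨_, hk⟩, 0), 0, rfl, rfl⟩
  | rising_rim hk => exact ⟨Sum.inr (⟨_, hk⟩, 2), 0, rfl, rfl⟩
  | rim_falling hk => exact ⟨Sum.inr (⟨_, hk⟩, 3), 1, rfl, rfl⟩
  | falling_rim hk => exact ⟨Sum.inr (⟨_, hk⟩, 1), 2, rfl, rfl⟩

theorem BoundaryEdge.not_dirEdge_reverse {a b : Vertex} (h : X.BoundaryEdge a b) :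
    ¬X.DirEdge b a := by
  rintro ⟨⟨j, k⟩ | ⟨k, x⟩, s, hb, ha⟩
  · cases h <;> fin_cases s <;> simp [label] at ha hb <;> grind
  · cases h <;> fin_cases x <;> fin_cases s <;> simp [label] at ha hb <;> grind

theorem BoundaryEdge.of_dirEdge {a b : Vertex} (h : X.DirEdge a b) (h' : ¬X.DirEdge b a) :
    X.BoundaryEdge a b := by
  obtain ⟨⟨j, k, hk⟩ | ⟨k, x⟩, s, rfl, rfl⟩ := h
  · fin_cases s
    · rcases k with _ | k
      · exact .apex_rim j.2
      · exact absurd (DirEdge.fan j.2 (by omega)).2.2 h'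
    · refine .rim_rim j.2 hk fun hkc => ⟨fun hj => h' ?_, fun hj => h' ?_⟩
      · exact ⟨Sum.inr (⟨k, hkc⟩, 1), 0, by simp [label, hj], by simp [label, hj]⟩
      · exact ⟨Sum.inr (⟨k, hkc⟩, 3), 0, by simp [label, hj], by simp [label, hj]⟩
    · rcases Nat.lt_succ_iff_lt_or_eq.1 hk with hkc | rfl
      · exact absurd (DirEdge.fan j.2 (Nat.succ_lt_succ hkc)).1 h'
      · exact .rim_apex j.2
  · have low : X.i k < X.n := Nat.lt_of_succ_lt (X.i_lt k k.2)
    have high := X.i_lt k k.2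
    fin_cases x <;> fin_cases s
    exacts [.rim_rising k.2, absurd ⟨Sum.inr (k, 2), 2, rfl, rfl⟩ h',
      absurd ⟨Sum.inr (k, 1), 1, rfl, rfl⟩ h', absurd (DirEdge.fan low (by omega)).2.1 h',
      absurd ⟨Sum.inr (k, 0), 2, rfl, rfl⟩ h', .falling_rim k.2, .rising_rim k.2,
      absurd ⟨Sum.inr (k, 3), 2, rfl, rfl⟩ h', absurd ⟨Sum.inr (k, 0), 1, rfl, rfl⟩ h',
      absurd (DirEdge.fan high (by omega)).2.1 h', .rim_falling k.2,
      absurd ⟨Sum.inr (k, 2), 1, rfl, rfl⟩ h']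

theorem exists_hasEdge_iff {p q : R3} : (∃ τ, X.surface.HasEdge τ p q) ↔
    ∃ a b, X.DirEdge a b ∧ X.pos a = p ∧ X.pos b = q := by
  constructor
  · rintro ⟨τ, s, rfl, rfl⟩
    exact ⟨_, _, ⟨τ, s, rfl, rfl⟩, rfl, rfl⟩
  · rintro ⟨_, _, ⟨τ, s, rfl, rfl⟩, rfl, rfl⟩
    exact ⟨τ, s, rfl, rfl⟩

theorem isBoundaryEdge_iff {p q : R3} : X.surface.IsBoundaryEdge p q ↔
    ∃ a b, X.BoundaryEdge a b ∧ X.pos a = p ∧ X.pos b = q := by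
  rw [OrientedTriangles.IsBoundaryEdge, ← not_exists, exists_hasEdge_iff, exists_hasEdge_iff]
  constructor
  · rintro ⟨⟨a, b, h, rfl, rfl⟩, h'⟩
    exact ⟨a, b, .of_dirEdge h fun hba => h' ⟨b, a, hba, rfl, rfl⟩, rfl, rfl⟩
  · rintro ⟨a, b, h, rfl, rfl⟩
    refine ⟨⟨a, b, h.dirEdge, rfl, rfl⟩, ?_⟩
    rintro ⟨b', a', hba, hb, ha⟩
    rw [pos_injective hb, pos_injective ha] at hba
    exact h.not_dirEdge_reverse hba

theorem mem_boundary_surface {p : R3} : p ∈ boundary X.surface.complex ↔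
    ∃ a b, X.BoundaryEdge a b ∧ p ∈ segment ℝ (X.pos a) (X.pos b) := by
  rw [OrientedTriangles.mem_boundary_complex]
  constructor
  · rintro ⟨_, _, h, hp⟩
    obtain ⟨a, b, hab, rfl, rfl⟩ := isBoundaryEdge_iff.1 h
    exact ⟨a, b, hab, hp⟩
  · rintro ⟨a, b, h, hp⟩
    exact ⟨_, _, isBoundaryEdge_iff.2 ⟨a, b, h, rfl, rfl⟩, hp⟩

theorem forall_of_isPreconnected_boundary (hX : IsPreconnected (boundary X.surface.complex))
    {P : Vertex → Prop} (hP : ∀ a b, X.BoundaryEdge a b → (P a ↔ P b)) {a b a' b' : Vertex}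
    (h : X.BoundaryEdge a b) (h' : X.BoundaryEdge a' b') (ha : P a) : P a' := by
  have pos_iff : ∀ u, (∃ u', X.pos u' = X.pos u ∧ P u') ↔ P u := fun u =>
    ⟨fun ⟨_, e, hu⟩ => pos_injective e ▸ hu, fun hu => ⟨u, rfl, hu⟩⟩
  refine (pos_iff a').1 <| OrientedTriangles.forall_of_isPreconnected_boundary hX
    (P := fun p => ∃ u, X.pos u = p ∧ P u) (fun p q hpq => ?_)
    (isBoundaryEdge_iff.2 ⟨a, b, h, rfl, rfl⟩) (isBoundaryEdge_iff.2 ⟨a', b', h', rfl, rfl⟩)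
    ((pos_iff a).2 ha)
  obtain ⟨u, u', huu', rfl, rfl⟩ := isBoundaryEdge_iff.1 hpq
  rw [pos_iff, pos_iff]
  exact hP u u' huu'

end Crossings

/-! ### Links and connectedness -/

namespace OrientedTriangles

variable {ι : Type*} {D : OrientedTriangles ι}

/-- Two triangles have an edge at the vertex `v` in common. -/
def AdjAt (D : OrientedTriangles ι) (v : R3) (τ τ' : ι) : Prop :=
  ∃ u, v ≠ u ∧ {v, u} ⊆ Set.range (D.v τ) ∧ {v, u} ⊆ Set.range (D.v τ')

instance (v : R3) : Std.Symm (D.AdjAt v) :=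
  ⟨fun _ _ ⟨u, hvu, h, h'⟩ => ⟨u, hvu, h', h⟩⟩

/-- Two triangles have a vertex in common. -/
def Touching (D : OrientedTriangles ι) (τ τ' : ι) : Prop :=
  ∃ s s', D.v τ s = D.v τ' s'

instance : Std.Symm D.Touching :=
  ⟨fun _ _ ⟨s, s', h⟩ => ⟨s', s, h.symm⟩⟩

theorem isConnected_space [Nonempty ι]
    (h : ∀ τ τ', Relation.ReflTransGen D.Touching τ τ') :
    IsConnected D.complex.space := by
  rw [space_complex]
  refine IsConnected.iUnion_of_reflTransGen
    (fun τ => (convex_convexHull ℝ _).isConnected (Set.range_nonempty _).convexHull)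
    fun τ τ' => Relation.ReflTransGen.mono ?_ _ _ (h τ τ')
  rintro σ σ' ⟨s, s', h⟩
  exact ⟨D.v σ s, subset_convexHull ℝ _ ⟨s, rfl⟩, subset_convexHull ℝ _ ⟨s', h.symm⟩⟩

theorem joined_of_joinedAt {v : R3} {τ τ' : ι} (h : Relation.ReflTransGen (D.AdjAt v) τ τ') :
    Relation.ReflTransGen (fun s' t' => ∃ e ∈ simplices D.complex 1, v ∈ e ∧
      s' ∈ trianglesAt D.complex e ∧ t' ∈ trianglesAt D.complex e) (D.tri τ) (D.tri τ') := by
  classical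
  refine h.lift D.tri fun σ σ' => ?_
  rintro ⟨u, hvu, h, h'⟩
  rw [← coe_tri, ← Finset.coe_pair, Finset.coe_subset] at h h'
  have hσ := tri_mem_simplices (D := D) σ
  exact ⟨{v, u}, ⟨D.complex.down_closed hσ.1 h ⟨v, by simp⟩, Finset.card_pair hvu⟩, by simp,
    ⟨hσ, h⟩, ⟨tri_mem_simplices σ', h'⟩⟩

end OrientedTriangles

namespace Crossings

variable {X : Crossings}

/-- Two triangles can be joined by a chain of triangles around the vertex `a`. -/
abbrev JoinedAt (X : Crossings) (a : Vertex) : X.Triangle → X.Triangle → Prop :=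
  Relation.ReflTransGen (X.surface.AdjAt (X.pos a))

theorem JoinedAt.symm {a : Vertex} {τ τ' : X.Triangle} (h : X.JoinedAt a τ τ') :
    X.JoinedAt a τ' τ :=
  Relation.ReflTransGen.stdSymm.symm _ _ h

theorem joinedAt_of_common_edge {τ τ' : X.Triangle} {a b : Vertex} (s t s' t' : Fin 3)
    (hab : a ≠ b) (hs : X.label τ s = a) (ht : X.label τ t = b) (hs' : X.label τ' s' = a)
    (ht' : X.label τ' t' = b) : X.JoinedAt a τ τ' := by
  refine .single ⟨X.pos b, pos_injective.ne hab, ?_, ?_⟩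
  · exact Set.pair_subset ⟨s, congrArg X.pos hs⟩ ⟨t, congrArg X.pos ht⟩
  · exact Set.pair_subset ⟨s', congrArg X.pos hs'⟩ ⟨t', congrArg X.pos ht'⟩

/-- The lower strand of a crossing. -/
def low (k : Fin X.c) : Fin X.n := ⟨X.i k, Nat.lt_of_succ_lt (X.i_lt k k.2)⟩

/-- The upper strand of a crossing. -/
def high (k : Fin X.c) : Fin X.n := ⟨X.i k + 1, X.i_lt k k.2⟩

/-- A triangle of the disk at the given vertex of its rim. -/
def rimTriangle (j : Fin X.n) (k : ℕ) : X.Triangle :=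
  Sum.inl (j, ⟨min k (X.c + 1), by omega⟩)

theorem joinedAt_rim_left {τ : X.Triangle} {j : Fin X.n} {k : ℕ} (hk : k < X.c + 2) (s t : Fin 3)
    (hs : X.label τ s = rim j k) (ht : X.label τ t = rim j (k + 1)) :
    X.JoinedAt (rim j k) τ (rimTriangle j k) := by
  have eq_disk : rimTriangle j k = (Sum.inl (j, ⟨k, hk⟩) : X.Triangle) := by
    simp only [rimTriangle, min_eq_left (Nat.le_of_lt_succ hk)]
  rw [eq_disk]
  exact joinedAt_of_common_edge s t 1 2 (by simp) hs ht rfl rfl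

theorem joinedAt_rim_right {τ : X.Triangle} {j : Fin X.n} {k : ℕ} (hk : k < X.c + 2) (s t : Fin 3)
    (hs : X.label τ s = rim j k) (ht : X.label τ t = rim j (k + 1)) :
    X.JoinedAt (rim j (k + 1)) τ (rimTriangle j (k + 1)) := by
  have disk : X.JoinedAt (rim j (k + 1)) τ (Sum.inl (j, ⟨k, hk⟩)) :=
    joinedAt_of_common_edge t s 2 1 (by simp) ht hs rfl rfl
  refine disk.trans ?_
  rcases Nat.lt_succ_iff_lt_or_eq.1 hk with h | rfl
  · refine joinedAt_of_common_edge (b := apex j) 2 0 1 0 (by simp) rfl rfl ?_ rfl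
    simp only [rimTriangle, label, Matrix.cons_val, min_eq_left (Nat.succ_le_of_lt h)]
  · have eq_disk : rimTriangle j (X.c + 2) = (Sum.inl (j, ⟨X.c + 1, hk⟩) : X.Triangle) := by
      simp [rimTriangle]
    rw [eq_disk]

theorem joinedAt_rimTriangle {τ : X.Triangle} {s : Fin 3} {j k : ℕ} (h : X.label τ s = rim j k) :
    ∃ hj : j < X.n, X.JoinedAt (rim j k) τ (rimTriangle ⟨j, hj⟩ k) := by
  rcases τ with ⟨j', k'⟩ | ⟨k', x⟩
  · fin_cases s <;> simp only [label, Fin.reduceFinMk, Matrix.cons_val, rim.injEq, reduceCtorEq]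
      at h
    all_goals obtain ⟨rfl, rfl⟩ := h
    · exact ⟨j'.2, joinedAt_rim_left k'.2 1 2 rfl rfl⟩
    · exact ⟨j'.2, joinedAt_rim_right k'.2 1 2 rfl rfl⟩
  · have hk : (k' : ℕ) < X.c + 2 := by omega
    have hlow := (low k').2
    have hhigh := (high k').2
    fin_cases x <;> fin_cases s <;>
      simp only [label, Fin.reduceFinMk, Matrix.cons_val, rim.injEq, reduceCtorEq] at h
    all_goals obtain ⟨rfl, rfl⟩ := h
    · exact ⟨hlow, .trans
        (joinedAt_of_common_edge (b := falling k') 0 2 1 2 (by simp) rfl rfl rfl rfl)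
        (joinedAt_rim_left (τ := Sum.inr (k', 1)) (j := low k') hk 1 0 rfl rfl)⟩
    · exact ⟨hlow, joinedAt_rim_right (j := low k') hk 1 0 rfl rfl⟩
    · exact ⟨hlow, joinedAt_rim_left (j := low k') hk 1 0 rfl rfl⟩
    · exact ⟨hhigh, .trans
        (joinedAt_of_common_edge (b := falling k') 1 2 0 2 (by simp) rfl rfl rfl rfl)
        (joinedAt_rim_right (τ := Sum.inr (k', 3)) (j := high k') hk 1 0 rfl rfl)⟩
    · exact ⟨hhigh, joinedAt_rim_right (j := high k') hk 1 0 rfl rfl⟩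
    · exact ⟨hhigh, joinedAt_rim_left (j := high k') hk 1 0 rfl rfl⟩

theorem joinedAt_apex_zero (j : Fin X.n) (k : Fin (X.c + 2)) :
    X.JoinedAt (apex j) (Sum.inl (j, k)) (Sum.inl (j, 0)) := by
  induction k using Fin.induction with
  | zero => exact .refl
  | succ k ih =>
    have succ_castSucc : X.JoinedAt (apex j) (Sum.inl (j, k.succ)) (Sum.inl (j, k.castSucc)) :=
      joinedAt_of_common_edge (b := rim j (k + 1)) 0 1 0 2 (by simp) rfl rfl rfl rfl
    exact succ_castSucc.trans ih

theorem joinedAt_apex {τ : X.Triangle} {s : Fin 3} {j : ℕ} (h : X.label τ s = apex j) :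
    ∃ hj : j < X.n, X.JoinedAt (apex j) τ (Sum.inl (⟨j, hj⟩, 0)) := by
  rcases τ with ⟨j', k'⟩ | ⟨k', x⟩
  · fin_cases s <;> simp only [label, Fin.reduceFinMk, Matrix.cons_val, apex.injEq, reduceCtorEq]
      at h
    subst h
    exact ⟨j'.2, joinedAt_apex_zero j' k'⟩
  · fin_cases x <;> fin_cases s <;> simp [label] at h

theorem joinedAt_rising {τ : X.Triangle} {s : Fin 3} {k : ℕ} (h : X.label τ s = rising k) :
    ∃ hk : k < X.c, X.JoinedAt (rising k) τ (Sum.inr (⟨k, hk⟩, 0)) := by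
  rcases τ with ⟨j', k'⟩ | ⟨k', x⟩
  · fin_cases s <;> simp [label] at h
  · fin_cases x <;> fin_cases s <;>
      simp only [label, Fin.reduceFinMk, Matrix.cons_val, rising.injEq, reduceCtorEq] at h
    all_goals subst h
    · exact ⟨k'.2, .refl⟩
    · exact ⟨k'.2, joinedAt_of_common_edge (b := falling k') 0 2 1 2 (by simp) rfl rfl rfl rfl⟩

theorem joinedAt_falling {τ : X.Triangle} {s : Fin 3} {k : ℕ} (h : X.label τ s = falling k) :
    ∃ hk : k < X.c, X.JoinedAt (falling k) τ (Sum.inr (⟨k, hk⟩, 0)) := by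
  rcases τ with ⟨j', k'⟩ | ⟨k', x⟩
  · fin_cases s <;> simp [label] at h
  · have two_zero : X.JoinedAt (falling k') (Sum.inr (k', 2)) (Sum.inr (k', 0)) :=
      joinedAt_of_common_edge (b := rising k') 2 0 2 1 (by simp) rfl rfl rfl rfl
    have one_zero : X.JoinedAt (falling k') (Sum.inr (k', 1)) (Sum.inr (k', 0)) :=
      joinedAt_of_common_edge (b := rim (X.i k') k') 2 1 2 0 (by simp) rfl rfl rfl rfl
    have three_two : X.JoinedAt (falling k') (Sum.inr (k', 3)) (Sum.inr (k', 2)) :=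
      joinedAt_of_common_edge (b := rim (X.i k' + 1) (k' + 1)) 2 0 2 1 (by simp) rfl rfl rfl rfl
    fin_cases x <;> fin_cases s <;>
      simp only [label, Fin.reduceFinMk, Matrix.cons_val, falling.injEq, reduceCtorEq] at h
    all_goals subst h
    exacts [⟨k'.2, .refl⟩, ⟨k'.2, one_zero⟩, ⟨k'.2, two_zero⟩, ⟨k'.2, three_two.trans two_zero⟩]

theorem joinedAt {τ τ' : X.Triangle} {s s' : Fin 3} {a : Vertex} (h : X.label τ s = a)
    (h' : X.label τ' s' = a) : X.JoinedAt a τ τ' := by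
  cases a with
  | rim j k =>
    obtain ⟨_, h⟩ := joinedAt_rimTriangle h
    obtain ⟨_, h'⟩ := joinedAt_rimTriangle h'
    exact h.trans h'.symm
  | apex j =>
    obtain ⟨_, h⟩ := joinedAt_apex h
    obtain ⟨_, h'⟩ := joinedAt_apex h'
    exact h.trans h'.symm
  | rising k =>
    obtain ⟨_, h⟩ := joinedAt_rising h
    obtain ⟨_, h'⟩ := joinedAt_rising h'
    exact h.trans h'.symm
  | falling k =>
    obtain ⟨_, h⟩ := joinedAt_falling h
    obtain ⟨_, h'⟩ := joinedAt_falling h'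
    exact h.trans h'.symm

theorem link_surface {v : R3} {s t : Finset R3} (hs : s ∈ trianglesAt X.surface.complex {v})
    (ht : t ∈ trianglesAt X.surface.complex {v}) :
    Relation.ReflTransGen (fun s' t' => ∃ e ∈ simplices X.surface.complex 1, v ∈ e ∧
      s' ∈ trianglesAt X.surface.complex e ∧ t' ∈ trianglesAt X.surface.complex e) s t := by
  obtain ⟨hs, hvs⟩ := hs
  obtain ⟨ht, hvt⟩ := ht
  rw [OrientedTriangles.simplices_two] at hs ht
  obtain ⟨τ, rfl⟩ := hs
  obtain ⟨τ', rfl⟩ := ht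
  rw [Finset.singleton_subset_iff, OrientedTriangles.mem_tri] at hvs hvt
  obtain ⟨a, rfl⟩ := hvs
  obtain ⟨a', ha'⟩ := hvt
  exact OrientedTriangles.joined_of_joinedAt (joinedAt rfl (pos_injective ha'))

/-- Two triangles can be joined by a chain of triangles with common vertices. -/
abbrev Joined (X : Crossings) : X.Triangle → X.Triangle → Prop :=
  Relation.ReflTransGen X.surface.Touching

theorem Joined.symm {τ τ' : X.Triangle} (h : X.Joined τ τ') : X.Joined τ' τ :=
  Relation.ReflTransGen.stdSymm.symm _ _ h

theorem joined_of_common_vertex {τ τ' : X.Triangle} (s s' : Fin 3)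
    (h : X.label τ s = X.label τ' s') : X.Joined τ τ' :=
  .single ⟨s, s', congrArg X.pos h⟩

theorem joined_disk (j : Fin X.n) (k k' : Fin (X.c + 2)) :
    X.Joined (Sum.inl (j, k)) (Sum.inl (j, k')) := joined_of_common_vertex 0 0 rfl

theorem joined_band (k : Fin X.c) (x x' : Fin 4) : X.Joined (Sum.inr (k, x)) (Sum.inr (k, x')) :=
  joined_of_common_vertex 2 2 (by fin_cases x <;> fin_cases x' <;> rfl)

theorem joined_band_low (k : Fin X.c) (x : Fin 4) (l : Fin (X.c + 2)) :
    X.Joined (Sum.inr (k, x)) (Sum.inl (low k, l)) :=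
  (joined_band k x 0).trans <|
    (joined_of_common_vertex (τ' := Sum.inl (low k, ⟨k, by omega⟩)) 0 1 rfl).trans
      (joined_disk _ _ _)

theorem joined_high_band (k : Fin X.c) (x : Fin 4) (l : Fin (X.c + 2)) :
    X.Joined (Sum.inl (high k, l)) (Sum.inr (k, x)) :=
  (joined_disk _ l ⟨k, by omega⟩).trans <|
    (joined_of_common_vertex (τ := Sum.inl (high k, _)) (τ' := Sum.inr (k, 3)) 1 1 rfl).trans
      (joined_band k 3 x)

section IsSurface

variable (hn : 0 < X.n) (hX : ∀ j, j + 1 < X.n → ∃ k < X.c, X.i k = j)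

include hX in
theorem joined_bottom_disk (τ : X.Triangle) : X.Joined τ (Sum.inl (⟨0, hn⟩, 0)) := by
  have disk : ∀ (j : ℕ) (hj : j < X.n), X.Joined (Sum.inl (⟨j, hj⟩, 0)) (Sum.inl (⟨0, hn⟩, 0)) := by
    intro j hj
    induction j with
    | zero => exact .refl
    | succ j ih =>
      obtain ⟨k, hk, rfl⟩ := hX j hj
      exact ((joined_high_band ⟨k, hk⟩ 0 0).trans (joined_band_low ⟨k, hk⟩ 0 0)).trans (ih _)
  rcases τ with ⟨j, k⟩ | ⟨k, x⟩
  · exact (joined_disk j k 0).trans (disk j j.2)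
  · exact (joined_band_low k x 0).trans (disk _ _)

include hn hX in
theorem isSurface : IsSurface X.surface.complex where
  finite := OrientedTriangles.finite_faces
  pure _ hs := OrientedTriangles.exists_triangle_of_mem_faces hs
  edge _ he := OrientedTriangles.ncard_trianglesAt_eq_one_or_two he
  link _ _ _ hs _ ht := link_surface hs ht
  connected :=
    have : Nonempty X.Triangle := ⟨Sum.inl (⟨0, hn⟩, 0)⟩
    OrientedTriangles.isConnected_space fun τ τ' =>
      (joined_bottom_disk hn hX τ).trans (joined_bottom_disk hn hX τ').symm
  orientable := OrientedTriangles.isOrientable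

end IsSurface

end Crossings

/-! ### The Euler characteristic -/

namespace Crossings

variable {X : Crossings}

/-- An enumeration of the vertices of the surface. -/
def vertexOf (X : Crossings) : (Fin X.n × Fin (X.c + 3)) ⊕ Fin X.n ⊕ Fin X.c ⊕ Fin X.c → Vertex
  | Sum.inl (j, k) => rim j k
  | Sum.inr (Sum.inl j) => apex j
  | Sum.inr (Sum.inr (Sum.inl k)) => rising k
  | Sum.inr (Sum.inr (Sum.inr k)) => falling k

theorem vertexOf_injective : Function.Injective X.vertexOf := by
  rintro (⟨j, k⟩ | j | k | k) (⟨j', k'⟩ | j' | k' | k') h <;> grind [vertexOf]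

theorem exists_vertexOf_label (τ : X.Triangle) (s : Fin 3) :
    ∃ u, X.vertexOf u = X.label τ s := by
  have exists_rim {j k : ℕ} (hj : j < X.n) (hk : k < X.c + 3) : ∃ u, X.vertexOf u = rim j k :=
    ⟨Sum.inl (⟨j, hj⟩, ⟨k, hk⟩), rfl⟩
  rcases τ with ⟨j, k⟩ | ⟨k, x⟩
  · fin_cases s
    exacts [⟨Sum.inr (Sum.inl j), rfl⟩, exists_rim j.2 (by omega), exists_rim j.2 (by omega)]
  · have exists_rising : ∃ u, X.vertexOf u = rising k := ⟨Sum.inr (Sum.inr (Sum.inl k)), rfl⟩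
    have exists_falling : ∃ u, X.vertexOf u = falling k := ⟨Sum.inr (Sum.inr (Sum.inr k)), rfl⟩
    have low_lt := (low k).2
    have high_lt := (high k).2
    fin_cases x <;> fin_cases s
    exacts [exists_rim low_lt (by omega), exists_rising, exists_falling,
      exists_rim low_lt (by omega), exists_rim low_lt (by omega), exists_falling,
      exists_rising, exists_rim high_lt (by omega), exists_falling,
      exists_rim high_lt (by omega), exists_rim high_lt (by omega), exists_falling]

theorem exists_label_eq_vertexOf (u) :
    ∃ (τ : X.Triangle) (s : Fin 3), X.label τ s = X.vertexOf u := by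
  rcases u with ⟨j, ⟨_ | k, hk⟩⟩ | j | k | k
  exacts [⟨Sum.inl (j, 0), 1, rfl⟩, ⟨Sum.inl (j, ⟨k, Nat.lt_of_succ_lt_succ hk⟩), 2, rfl⟩,
    ⟨Sum.inl (j, 0), 0, rfl⟩, ⟨Sum.inr (k, 0), 1, rfl⟩, ⟨Sum.inr (k, 0), 2, rfl⟩]

theorem ncard_vertices :
    (simplices X.surface.complex 0).ncard = X.n * (X.c + 3) + (X.n + (X.c + X.c)) := by
  have vertices_eq_range : simplices X.surface.complex 0 =
      Set.range fun u => ({X.pos (X.vertexOf u)} : Finset R3) := by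
    ext e
    rw [OrientedTriangles.mem_simplices_zero]
    constructor
    · rintro ⟨τ, s, rfl⟩
      obtain ⟨u, hu⟩ := exists_vertexOf_label τ s
      exact ⟨u, by simp only [hu]; rfl⟩
    · rintro ⟨u, rfl⟩
      obtain ⟨τ, s, h⟩ := exists_label_eq_vertexOf u
      exact ⟨τ, s, by simp only [← h]; rfl⟩
  rw [vertices_eq_range, Set.ncard_range_of_injective]
  · simp
  · exact Finset.singleton_injective.comp (pos_injective.comp vertexOf_injective)

/-- An enumeration of the edges of the surface, each with one of its two directions. -/
def edgeOf (X : Crossings) :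
    (Fin X.n × Fin (X.c + 3)) ⊕ (Fin X.n × Fin (X.c + 2)) ⊕ (Fin X.c × Fin 7) → Vertex × Vertex
  | Sum.inl (j, k) => (apex j, rim j k)
  | Sum.inr (Sum.inl (j, k)) => (rim j k, rim j (k + 1))
  | Sum.inr (Sum.inr (k, 0)) => (rim (X.i k) k, rising k)
  | Sum.inr (Sum.inr (k, 1)) => (rising k, rim (X.i k + 1) (k + 1))
  | Sum.inr (Sum.inr (k, 2)) => (rim (X.i k + 1) k, falling k)
  | Sum.inr (Sum.inr (k, 3)) => (falling k, rim (X.i k) (k + 1))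
  | Sum.inr (Sum.inr (k, 4)) => (rising k, falling k)
  | Sum.inr (Sum.inr (k, 5)) => (falling k, rim (X.i k) k)
  | Sum.inr (Sum.inr (k, 6)) => (falling k, rim (X.i k + 1) (k + 1))

theorem edgeOf_injective {x x'} (h : X.edgeOf x = X.edgeOf x' ∨ X.edgeOf x = (X.edgeOf x').swap) :
    x = x' := by
  rcases x with ⟨j, k⟩ | ⟨j, k⟩ | ⟨k, y⟩ <;> rcases x' with ⟨j', k'⟩ | ⟨j', k'⟩ | ⟨k', y'⟩
  · grind [edgeOf, Prod.swap]
  · grind [edgeOf, Prod.swap]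
  · fin_cases y' <;> grind [edgeOf, Prod.swap]
  · grind [edgeOf, Prod.swap]
  · grind [edgeOf, Prod.swap]
  · fin_cases y' <;> grind [edgeOf, Prod.swap]
  · fin_cases y <;> grind [edgeOf, Prod.swap]
  · fin_cases y <;> grind [edgeOf, Prod.swap]
  · fin_cases y <;> fin_cases y' <;> grind [edgeOf, Prod.swap]

theorem dirEdge_edgeOf (x) : X.DirEdge (X.edgeOf x).1 (X.edgeOf x).2 ∨
    X.DirEdge (X.edgeOf x).2 (X.edgeOf x).1 := by
  rcases x with ⟨j, ⟨_ | k, hk⟩⟩ | ⟨j, k⟩ | ⟨k, y⟩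
  · exact .inl (DirEdge.fan j.2 (Nat.succ_pos _)).1
  · exact .inr (DirEdge.fan j.2 (Nat.lt_of_succ_lt_succ hk)).2.2
  · exact .inl (DirEdge.fan j.2 k.2).2.1
  · left
    fin_cases y
    exacts [⟨Sum.inr (k, 0), 0, rfl, rfl⟩, ⟨Sum.inr (k, 2), 0, rfl, rfl⟩,
      ⟨Sum.inr (k, 3), 1, rfl, rfl⟩, ⟨Sum.inr (k, 1), 2, rfl, rfl⟩,
      ⟨Sum.inr (k, 0), 1, rfl, rfl⟩, ⟨Sum.inr (k, 0), 2, rfl, rfl⟩,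
      ⟨Sum.inr (k, 3), 2, rfl, rfl⟩]

theorem DirEdge.exists_edgeOf {a b : Vertex} (h : X.DirEdge a b) :
    ∃ x, X.edgeOf x = (a, b) ∨ X.edgeOf x = (b, a) := by
  obtain ⟨⟨j, k⟩ | ⟨k, x⟩, s, rfl, rfl⟩ := h
  · fin_cases s
    exacts [⟨Sum.inl (j, k.castSucc), .inl rfl⟩, ⟨Sum.inr (Sum.inl (j, k)), .inl rfl⟩,
      ⟨Sum.inl (j, k.succ), .inr rfl⟩]
  · have band {a b : Vertex} (y : Fin 7) (h : X.edgeOf (Sum.inr (Sum.inr (k, y))) = (a, b) ∨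
        X.edgeOf (Sum.inr (Sum.inr (k, y))) = (b, a)) :
        ∃ x, X.edgeOf x = (a, b) ∨ X.edgeOf x = (b, a) := ⟨_, h⟩
    have hk : (k : ℕ) < X.c + 2 := by omega
    fin_cases x <;> fin_cases s
    exacts [band 0 (.inl rfl), band 4 (.inl rfl), band 5 (.inl rfl),
      ⟨Sum.inr (Sum.inl (low k, ⟨k, hk⟩)), .inr rfl⟩, band 5 (.inr rfl), band 3 (.inl rfl),
      band 1 (.inl rfl), band 6 (.inr rfl), band 4 (.inr rfl),
      ⟨Sum.inr (Sum.inl (high k, ⟨k, hk⟩)), .inr rfl⟩, band 2 (.inl rfl), band 6 (.inl rfl)]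

open Classical in
theorem edges_eq_range : simplices X.surface.complex 1 = Set.range fun x =>
    ({X.pos (X.edgeOf x).1, X.pos (X.edgeOf x).2} : Finset R3) := by
  ext e
  simp only [OrientedTriangles.mem_simplices_one, Set.mem_range]
  constructor
  · rintro ⟨τ, _, _, ⟨s, rfl, rfl⟩, rfl⟩
    obtain ⟨x, hx | hx⟩ := DirEdge.exists_edgeOf (X := X) ⟨τ, s, rfl, rfl⟩
    · exact ⟨x, by simp only [hx]; rfl⟩
    · exact ⟨x, by simp only [hx]; exact Finset.pair_comm _ _⟩
  · rintro ⟨x, rfl⟩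
    rcases dirEdge_edgeOf x with ⟨τ, s, h1, h2⟩ | ⟨τ, s, h1, h2⟩
    · exact ⟨τ, _, _, ⟨s, rfl, rfl⟩, by simp only [← h1, ← h2]; rfl⟩
    · exact ⟨τ, _, _, ⟨s, rfl, rfl⟩, by simp only [← h1, ← h2]; exact Finset.pair_comm _ _⟩

theorem ncard_edges : (simplices X.surface.complex 1).ncard =
    X.n * (X.c + 3) + (X.n * (X.c + 2) + X.c * 7) := by
  rw [edges_eq_range, Set.ncard_range_of_injective]
  · simp
  · intro x x' h
    apply edgeOf_injective
    have h := congrArg (fun s : Finset R3 => (s : Set R3)) h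
    simp only [Finset.coe_pair, Set.pair_eq_pair_iff, pos_injective.eq_iff] at h
    simpa only [Prod.ext_iff, Prod.fst_swap, Prod.snd_swap] using h

theorem ncard_triangles :
    (simplices X.surface.complex 2).ncard = X.n * (X.c + 2) + X.c * 4 := by
  rw [OrientedTriangles.simplices_two,
    Set.ncard_range_of_injective OrientedTriangles.tri_injective]
  simp

theorem eulerChar_surface : eulerChar X.surface.complex = (X.n : ℤ) - X.c := by
  rw [eulerChar, ncard_vertices, ncard_edges, ncard_triangles]
  push_cast
  ring

end Crossings

/-! ### The permutation of a braid -/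

theorem sign_of_forall_sameCycle {α : Type*} [Fintype α] [DecidableEq α] [Nonempty α]
    {σ : Equiv.Perm α} (h : ∀ x y, σ.SameCycle x y) :
    Equiv.Perm.sign σ = (-1) ^ (Fintype.card α + 1) := by
  rcases subsingleton_or_nontrivial α with hα | hα
  · have card_eq_one : Fintype.card α = 1 :=
      le_antisymm (Fintype.card_le_one_iff_subsingleton.2 hα) Fintype.card_pos
    rw [Subsingleton.elim σ 1, Equiv.Perm.sign_one, card_eq_one, one_add_one_eq_two,
      even_two.neg_one_pow]
  have apply_ne (x : α) : σ x ≠ x := by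
    intro hx
    obtain ⟨y, hy⟩ := exists_ne x
    exact hy ((h x y).eq_of_left hx).symm
  have isCycle : σ.IsCycle := ⟨Classical.arbitrary α, apply_ne _, fun y _ => h _ y⟩
  have support_eq : σ.support = Finset.univ :=
    Finset.eq_univ_of_forall fun x => Equiv.Perm.mem_support.2 (apply_ne x)
  rw [isCycle.sign, support_eq, Finset.card_univ, pow_succ, mul_neg_one]

namespace Crossings

variable {X : Crossings}

/-- The transposition of the two strands that meet at the `k`-th crossing, and `1` if there are at
most `k` crossings. -/
def transposition (X : Crossings) (k : ℕ) : Equiv.Perm (Fin X.n) :=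
  if h : k < X.c then Equiv.swap (low ⟨k, h⟩) (high ⟨k, h⟩) else 1

/-- The permutation of the strands by the first `k` crossings. -/
def perm (X : Crossings) : ℕ → Equiv.Perm (Fin X.n)
  | 0 => 1
  | k + 1 => X.transposition k * X.perm k

theorem transposition_of_lt {k : ℕ} (h : k < X.c) :
    X.transposition k = Equiv.swap (low ⟨k, h⟩) (high ⟨k, h⟩) := dif_pos h

theorem transposition_of_le {k : ℕ} (h : X.c ≤ k) : X.transposition k = 1 := dif_neg h.not_gt

theorem transposition_apply_of_ne {j k : ℕ} (hj : j < X.n)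
    (h : k < X.c → j ≠ X.i k ∧ j ≠ X.i k + 1) : X.transposition k ⟨j, hj⟩ = ⟨j, hj⟩ := by
  rcases lt_or_ge k X.c with hk | hk
  · rw [transposition_of_lt hk]
    exact Equiv.swap_apply_of_ne_of_ne (Fin.ne_of_val_ne (h hk).1) (Fin.ne_of_val_ne (h hk).2)
  · rw [transposition_of_le hk, Equiv.Perm.one_apply]

theorem perm_succ_inv_apply (k : ℕ) (x : Fin X.n) :
    (X.perm (k + 1))⁻¹ x = (X.perm k)⁻¹ (X.transposition k x) := by
  have inv_eq : (X.transposition k)⁻¹ = X.transposition k := by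
    rcases lt_or_ge k X.c with hk | hk
    · rw [transposition_of_lt hk, Equiv.swap_inv]
    · rw [transposition_of_le hk, inv_one]
  rw [perm, mul_inv_rev, inv_eq, Equiv.Perm.mul_apply]

theorem perm_succ_inv_low {k : ℕ} (hk : k < X.c) :
    (X.perm (k + 1))⁻¹ (low ⟨k, hk⟩) = (X.perm k)⁻¹ (high ⟨k, hk⟩) := by
  rw [perm_succ_inv_apply, transposition_of_lt hk, Equiv.swap_apply_left]

theorem perm_succ_inv_high {k : ℕ} (hk : k < X.c) :
    (X.perm (k + 1))⁻¹ (high ⟨k, hk⟩) = (X.perm k)⁻¹ (low ⟨k, hk⟩) := by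
  rw [perm_succ_inv_apply, transposition_of_lt hk, Equiv.swap_apply_right]

theorem sign_perm {k : ℕ} (hk : k ≤ X.c) : Equiv.Perm.sign (X.perm k) = (-1) ^ k := by
  induction k with
  | zero => exact Equiv.Perm.sign_one
  | succ k ih =>
    have low_ne_high : low ⟨k, hk⟩ ≠ high ⟨k, hk⟩ := Fin.ne_of_val_ne (Nat.succ_ne_self _).symm
    rw [perm, Equiv.Perm.sign_mul, ih (Nat.le_of_succ_le hk), transposition_of_lt hk,
      Equiv.Perm.sign_swap low_ne_high, pow_succ, mul_comm]

/-- The vertices on the boundary that lie on one of the strands in `S`, where every strand is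
denoted by the height at which it starts. -/
def OnStrands (S : Set (Fin X.n)) : Vertex → Prop
  | rim j k => ∃ h : j < X.n, (X.perm k)⁻¹ ⟨j, h⟩ ∈ S
  | apex j => ∃ h : j < X.n, ⟨j, h⟩ ∈ S
  | rising k => ∃ h : k < X.c, (X.perm k)⁻¹ (low ⟨k, h⟩) ∈ S
  | falling k => ∃ h : k < X.c, (X.perm k)⁻¹ (high ⟨k, h⟩) ∈ S

theorem onStrands_rim {S : Set (Fin X.n)} (j : Fin X.n) (k : ℕ) :
    OnStrands S (rim j k) ↔ (X.perm k)⁻¹ j ∈ S := ⟨fun ⟨_, h⟩ => h, fun h => ⟨j.2, h⟩⟩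

theorem onStrands_apex {S : Set (Fin X.n)} (j : Fin X.n) : OnStrands S (apex j) ↔ j ∈ S :=
  ⟨fun ⟨_, h⟩ => h, fun h => ⟨j.2, h⟩⟩

theorem onStrands_rising {S : Set (Fin X.n)} (k : Fin X.c) :
    OnStrands S (rising k) ↔ (X.perm k)⁻¹ (low k) ∈ S := ⟨fun ⟨_, h⟩ => h, fun h => ⟨k.2, h⟩⟩

theorem onStrands_falling {S : Set (Fin X.n)} (k : Fin X.c) :
    OnStrands S (falling k) ↔ (X.perm k)⁻¹ (high k) ∈ S := ⟨fun ⟨_, h⟩ => h, fun h => ⟨k.2, h⟩⟩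

theorem BoundaryEdge.onStrands_iff {S : Set (Fin X.n)} (hS : ∀ x, X.perm X.c x ∈ S ↔ x ∈ S)
    {a b : Vertex} (h : X.BoundaryEdge a b) : OnStrands S a ↔ OnStrands S b := by
  cases h with
  | @apex_rim j hj => exact (onStrands_apex ⟨j, hj⟩).trans (onStrands_rim ⟨j, hj⟩ 0).symm
  | @rim_rim j k hj hk h =>
    rw [onStrands_rim ⟨j, hj⟩ k, onStrands_rim ⟨j, hj⟩ (k + 1), perm_succ_inv_apply,
      transposition_apply_of_ne hj h]
  | @rim_apex j hj =>
    have perm_last : X.perm (X.c + 2) = X.perm X.c := by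
      simp only [perm, transposition_of_le (Nat.le_succ X.c), transposition_of_le (le_refl X.c),
        one_mul]
    rw [onStrands_rim ⟨j, hj⟩, onStrands_apex ⟨j, hj⟩, perm_last, ← hS, Equiv.Perm.coe_inv,
      Equiv.apply_symm_apply]
  | @rim_rising k hk =>
    exact (onStrands_rim (low ⟨k, hk⟩) k).trans (onStrands_rising ⟨k, hk⟩).symm
  | @rising_rim k hk =>
    rw [onStrands_rising ⟨k, hk⟩, ← perm_succ_inv_high]
    exact (onStrands_rim (high ⟨k, hk⟩) (k + 1)).symm
  | @rim_falling k hk =>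
    exact (onStrands_rim (high ⟨k, hk⟩) k).trans (onStrands_falling ⟨k, hk⟩).symm
  | @falling_rim k hk =>
    rw [onStrands_falling ⟨k, hk⟩, ← perm_succ_inv_low]
    exact (onStrands_rim (low ⟨k, hk⟩) (k + 1)).symm

section Connected

variable (hX : IsPreconnected (boundary X.surface.complex))

include hX

theorem mem_of_invariant {S : Set (Fin X.n)} (hS : ∀ x, X.perm X.c x ∈ S ↔ x ∈ S) {x : Fin X.n}
    (hx : x ∈ S) (y : Fin X.n) : y ∈ S :=
  (onStrands_apex y).1 <| forall_of_isPreconnected_boundary hX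
    (fun _ _ h => h.onStrands_iff hS) (.apex_rim x.2) (.apex_rim y.2) ((onStrands_apex x).2 hx)

theorem sameCycle_perm (x y : Fin X.n) : (X.perm X.c).SameCycle x y :=
  mem_of_invariant hX (S := {y | (X.perm X.c).SameCycle x y})
    (fun _ => Equiv.Perm.sameCycle_apply_right) (Equiv.Perm.SameCycle.refl _ _) y

theorem exists_crossing {j : ℕ} (hj : j + 1 < X.n) : ∃ k < X.c, X.i k = j := by
  by_contra! h
  have transposition_le_iff (k : ℕ) (x : Fin X.n) :
      (X.transposition k x : ℕ) ≤ j ↔ (x : ℕ) ≤ j := by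
    rcases lt_or_ge k X.c with hk | hk
    · have := h k hk
      rw [transposition_of_lt hk]
      grind [low, high]
    · rw [transposition_of_le hk, Equiv.Perm.one_apply]
  have perm_le_iff (k : ℕ) (x : Fin X.n) : (X.perm k x : ℕ) ≤ j ↔ (x : ℕ) ≤ j := by
    induction k with
    | zero => rfl
    | succ k ih => rw [perm, Equiv.Perm.mul_apply, transposition_le_iff, ih]
  exact Nat.not_succ_le_self j <| mem_of_invariant hX (S := {x | (x : ℕ) ≤ j}) (perm_le_iff X.c)
    (x := ⟨0, by omega⟩) (Nat.zero_le _) ⟨j + 1, hj⟩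

theorem n_le_c_add_one : X.n ≤ X.c + 1 := by
  choose! f hf using fun j (hj : j + 1 < X.n) => exists_crossing hX hj
  have card_le : (Finset.range (X.n - 1)).card ≤ (Finset.range X.c).card := by
    refine Finset.card_le_card_of_injOn f (fun j hj => ?_) fun j hj j' hj' h => ?_
    · exact Finset.mem_coe.2 (Finset.mem_range.2 (hf j (by grind)).1)
    · rw [← (hf j (by grind)).2, h, (hf j' (by grind)).2]
  simp only [Finset.card_range] at card_le
  omega

theorem odd_c_sub_n (hn : 0 < X.n) : Odd ((X.c : ℤ) - X.n) := by
  have : Nonempty (Fin X.n) := ⟨⟨0, hn⟩⟩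
  have sign_eq := sign_of_forall_sameCycle (sameCycle_perm hX)
  rw [sign_perm le_rfl, Fintype.card_fin, ← zpow_natCast, ← zpow_natCast, ← Int.negOnePow_def,
    ← Int.negOnePow_def, Int.negOnePow_eq_iff] at sign_eq
  grind

end Connected

end Crossings

/-! ### The closed braid as the boundary of its Seifert surface -/

/-- The crossings of a braid word. -/
def crossings {n : ℕ} (w : BraidWord n) : Crossings where
  n := n
  c := w.length
  i k := if h : k < w.length then (w[k].1 : ℕ) else 0
  ε k := if h : k < w.length then (if w[k].2 then 1 else -1) else 1
  i_lt k hk := by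
    rw [dif_pos hk]
    omega
  ε_sq k := by
    split_ifs <;> norm_num

section boundary

variable {n : ℕ} {w : BraidWord n}

open Crossings

theorem crossings_i {k : ℕ} (h : k < w.length) : (crossings w).i k = w[k].1 := dif_pos h

theorem crossings_ε {k : ℕ} (h : k < w.length) :
    (crossings w).ε k = if w[k].2 then 1 else -1 := dif_pos h

theorem crossingColumn_eq {k : ℕ} (hk : k < w.length) :
    letI X := crossings w
    crossingColumn n k w[k] =
      (⋃ j ∈ {j | j < n ∧ j ≠ X.i k ∧ j ≠ X.i k + 1},
        segment ℝ (X.pos (rim j k)) (X.pos (rim j (k + 1)))) ∪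
      (segment ℝ (X.pos (rim (X.i k) k)) (X.pos (rising k)) ∪
        segment ℝ (X.pos (rising k)) (X.pos (rim (X.i k + 1) (k + 1)))) ∪
      (segment ℝ (X.pos (rim (X.i k + 1) k)) (X.pos (falling k)) ∪
        segment ℝ (X.pos (falling k)) (X.pos (rim (X.i k) (k + 1)))) := by
  have hc : k ≤ (crossings w).c := hk.le
  simp only [pos_rim (Nat.le_succ_of_le hc), pos_rim_succ hc]
  simp only [pos, crossings_i hk, crossings_ε hk, Nat.cast_succ]
  rfl

theorem closingArc_eq (j : ℕ) :
    letI X := crossings w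
    closingArc w.length j =
      segment ℝ (X.pos (rim j X.c)) (X.pos (rim j (X.c + 1))) ∪
      segment ℝ (X.pos (rim j (X.c + 1))) (X.pos (rim j (X.c + 2))) ∪
      segment ℝ (X.pos (rim j (X.c + 2))) (X.pos (apex j)) ∪
      segment ℝ (X.pos (apex j)) (X.pos (rim j 0)) := by
  rw [pos_rim (Nat.le_succ _), pos_rim_succ le_rfl, pos_rim_last, pos_rim (Nat.zero_le _),
    Nat.cast_zero]
  rfl

theorem mem_closedBraid {p : R3} : p ∈ closedBraid w ↔
    (∃ (k : ℕ) (h : k < w.length), p ∈ crossingColumn n k w[k]) ∨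
      ∃ j < n, p ∈ closingArc w.length j := by
  simp only [closedBraid, Set.mem_union, Set.mem_iUnion, Fin.exists_iff, exists_prop,
    List.get_eq_getElem]

theorem closedBraid_subset_boundary : closedBraid w ⊆ boundary (crossings w).surface.complex := by
  intro p hp
  rw [mem_boundary_surface]
  rcases mem_closedBraid.1 hp with ⟨k, hk, hp⟩ | ⟨j, hj, hp⟩
  · rw [crossingColumn_eq hk] at hp
    rcases hp with (hp | hp | hp) | hp | hp
    · obtain ⟨j, ⟨hj, hi⟩, hp⟩ := Set.mem_iUnion₂.1 hp
      exact ⟨_, _, .rim_rim hj (Nat.lt_add_right 2 hk) fun _ => hi, hp⟩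
    · exact ⟨_, _, .rim_rising hk, hp⟩
    · exact ⟨_, _, .rising_rim hk, hp⟩
    · exact ⟨_, _, .rim_falling hk, hp⟩
    · exact ⟨_, _, .falling_rim hk, hp⟩
  · rw [closingArc_eq] at hp
    rcases hp with ((hp | hp) | hp) | hp
    · exact ⟨_, _, .rim_rim hj (by omega) (by omega), hp⟩
    · exact ⟨_, _, .rim_rim hj (by omega) (by omega), hp⟩
    · exact ⟨_, _, .rim_apex hj, hp⟩
    · exact ⟨_, _, .apex_rim hj, hp⟩

theorem boundary_subset_closedBraid : boundary (crossings w).surface.complex ⊆ closedBraid w := by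
  intro p hp
  rw [mem_boundary_surface] at hp
  obtain ⟨a, b, h, hp⟩ := hp
  have column {k : ℕ} (hk : k < w.length) (h : p ∈ crossingColumn n k w[k]) : p ∈ closedBraid w :=
    mem_closedBraid.2 (.inl ⟨k, hk, h⟩)
  have arc {j : ℕ} (hj : j < n) (h : p ∈ closingArc w.length j) : p ∈ closedBraid w :=
    mem_closedBraid.2 (.inr ⟨j, hj, h⟩)
  cases h with
  | apex_rim hj => exact arc hj (closingArc_eq (w := w) _ ▸ .inr hp)
  | rim_apex hj => exact arc hj (closingArc_eq (w := w) _ ▸ .inl (.inr hp))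
  | @rim_rim j k hj hk h =>
    rcases lt_trichotomy k w.length with hk' | rfl | hk'
    · refine column hk' (crossingColumn_eq hk' ▸ .inl (.inl ?_))
      exact Set.mem_biUnion (x := j) ⟨hj, h hk'⟩ hp
    · exact arc hj (closingArc_eq (w := w) _ ▸ .inl (.inl (.inl hp)))
    · obtain rfl : k = w.length + 1 := by have : k < w.length + 2 := hk; omega
      exact arc hj (closingArc_eq (w := w) _ ▸ .inl (.inl (.inr hp)))
  | rim_rising hk => exact column hk (crossingColumn_eq hk ▸ .inl (.inr (.inl hp)))
  | rising_rim hk => exact column hk (crossingColumn_eq hk ▸ .inl (.inr (.inr hp)))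
  | rim_falling hk => exact column hk (crossingColumn_eq hk ▸ .inr (.inl hp))
  | falling_rim hk => exact column hk (crossingColumn_eq hk ▸ .inr (.inr hp))

theorem boundary_surface : boundary (crossings w).surface.complex = closedBraid w :=
  boundary_subset_closedBraid.antisymm closedBraid_subset_boundary

end boundary

/-! ### The lengths of the braids that represent a knot -/

theorem IsSimpleClosedPolygon.isConnected {P : Set R3} (h : IsSimpleClosedPolygon P) :
    IsConnected P := by
  obtain ⟨m, hm, v, -, -, rfl⟩ := h
  have : NeZero m := ⟨by omega⟩
  have iUnion_eq : (⋃ i : ZMod m, segment ℝ (v i) (v (i + 1))) =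
      ⋃ k : ℕ, segment ℝ (v k) (v (k + 1)) :=
    ((ZMod.natCast_zmod_surjective (n := m)).iUnion_comp _).symm
  rw [iUnion_eq]
  refine IsConnected.iUnion_of_chain
    (fun k => (convex_segment _ _).isConnected ⟨_, left_mem_segment ℝ _ _⟩)
    fun k => ⟨v (k + 1), right_mem_segment ℝ _ _, ?_⟩
  rw [Nat.succ_eq_succ, Nat.cast_succ]
  exact left_mem_segment ℝ _ _

theorem IsKnot.isConnected {K : Set R3} (h : IsKnot K) : IsConnected K := by
  obtain ⟨e, he⟩ := h
  exact e.isConnected_image.1 he.isConnected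

namespace Represents

variable {n : ℕ} {w : BraidWord n} {K : Set R3}

theorem exists_homeomorph (h : Represents w K) : ∃ e : R3 ≃ₜ R3, e '' closedBraid w = K :=
  let ⟨F, _, _, hF⟩ := h
  ⟨F 1, hF⟩

theorem pos (hK : K.Nonempty) (h : Represents w K) : 0 < n := by
  obtain ⟨e, rfl⟩ := h.exists_homeomorph
  obtain ⟨p, hp⟩ := hK.of_image
  rcases mem_closedBraid.1 hp with ⟨k, hk, -⟩ | ⟨j, hj, -⟩
  · have := w[k].1.2
    omega
  · exact Nat.zero_lt_of_lt hj

theorem exists_stabilization (hK : K.Nonempty) (h : Represents w K) :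
    ∃ w' : BraidWord (n + 1), w'.length = w.length + 1 ∧ Represents w' K := by
  obtain ⟨m, rfl⟩ := Nat.exists_eq_succ_of_ne_zero (h.pos hK).ne'
  exact ⟨stabilize w, length_stabilize w, (ambientIsotopic_stabilize w).symm.trans h⟩

theorem isPreconnected_boundary (hK : IsPreconnected K) (h : Represents w K) :
    IsPreconnected (boundary (crossings w).surface.complex) := by
  obtain ⟨e, rfl⟩ := h.exists_homeomorph
  rw [boundary_surface]
  exact e.isPreconnected_image.1 hK

theorem odd (hK : IsConnected K) (h : Represents w K) : Odd ((w.length : ℤ) - n) :=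
  Crossings.odd_c_sub_n (h.isPreconnected_boundary hK.isPreconnected) (h.pos hK.nonempty)

theorem isSeifertSurface (hK : IsConnected K) (h : Represents w K) {g : ℕ}
    (hg : (w.length : ℤ) - n = 2 * g - 1) : ∃ S, IsSeifertSurface S K g := by
  have isPreconnected := h.isPreconnected_boundary hK.isPreconnected
  obtain ⟨e, rfl⟩ := h.exists_homeomorph
  refine ⟨e '' (crossings w).surface.complex.space, e.symm, (crossings w).surface.complex,
    Crossings.isSurface (h.pos hK.nonempty) fun j => Crossings.exists_crossing isPreconnected,
    e.toEquiv.symm_image_image _, ?_, ?_⟩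
  · rw [boundary_surface]
    exact e.toEquiv.symm_image_image _
  · rw [Crossings.eulerChar_surface]
    change (n : ℤ) - w.length = _
    omega

theorem genus_le (hK : IsConnected K) (h : Represents w K) :
    2 * (genus K : ℤ) - 1 ≤ (w.length : ℤ) - n := by
  obtain ⟨r, hr⟩ := h.odd hK
  have hle : n ≤ w.length + 1 :=
    Crossings.n_le_c_add_one (h.isPreconnected_boundary hK.isPreconnected)
  have hg : (w.length : ℤ) - n = 2 * (r + 1).toNat - 1 := by omega
  have : genus K ≤ (r + 1).toNat := Nat.sInf_le (h.isSeifertSurface hK hg)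
  omega

end Represents

section Nonempty

variable {K : Set R3} (hK : K.Nonempty) {n : ℕ} (hn : braidIndex K ≤ n)

include hK hn

theorem exists_represents_of_braidIndex_le : ∃ w : BraidWord n, Represents w K := by
  obtain ⟨m, ⟨w, hw⟩, hm⟩ : ∃ m ∈ {m : ℕ | ∃ w : BraidWord m, Represents w K}, m ≤ n := by
    have : braidIndex K < (n + 1 : ℕ) := hn.trans_lt (Nat.cast_lt.2 n.lt_succ_self)
    simpa only [braidIndex, iInf_lt_iff, Nat.cast_lt, Nat.lt_succ_iff, exists_prop] using this
  clear hn
  induction n, hm using Nat.le_induction with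
  | base => exact ⟨w, hw⟩
  | succ k _ ih =>
    obtain ⟨w', hw'⟩ := ih
    obtain ⟨w'', -, hw''⟩ := hw'.exists_stabilization hK
    exact ⟨w'', hw''⟩

theorem isLeast_b : IsLeast (lengthSet n K) (b n K) := by
  obtain ⟨w, hw⟩ := exists_represents_of_braidIndex_le hK hn
  exact ⟨Nat.sInf_mem ⟨_, w, rfl, hw⟩, fun _ hc => Nat.sInf_le hc⟩

theorem exists_represents_b'_eq :
    ∃ w : BraidWord n, Represents w K ∧ b' n K = (w.length : ℤ) - n := by
  obtain ⟨w, hw, h⟩ := (isLeast_b hK hn).1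
  exact ⟨w, h, by rw [b', hw]⟩

theorem b'_succ_le : b' (n + 1) K ≤ b' n K := by
  obtain ⟨w, h, hw⟩ := exists_represents_b'_eq hK hn
  obtain ⟨w', hw', h'⟩ := h.exists_stabilization hK
  have : b (n + 1) K ≤ w'.length := Nat.sInf_le ⟨w', rfl, h'⟩
  rw [hw, b']
  omega

end Nonempty

theorem antitoneOn_b' {K : Set R3} (hK : K.Nonempty) :
    AntitoneOn (fun n : ℕ => b' n K) {n : ℕ | braidIndex K ≤ n} := by
  intro n hn m _ hnm
  induction m, hnm using Nat.le_induction with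
  | base => exact le_rfl
  | succ k hk ih =>
    have hk' : braidIndex K ≤ k := le_trans hn (Nat.cast_le.2 hk)
    exact (b'_succ_le hK hk').trans (ih hk')

end BraidLength

end

theorem theorem1p4 (K : Set BraidLength.R3) (hK : BraidLength.IsKnot K) :
    (∀ n : ℕ, BraidLength.braidIndex K ≤ n →
      IsLeast (BraidLength.lengthSet n K) (BraidLength.b n K)) ∧
    AntitoneOn (fun n : ℕ => BraidLength.b' n K) {n : ℕ | BraidLength.braidIndex K ≤ n} ∧
    (∀ n : ℕ, BraidLength.braidIndex K ≤ n → Odd (BraidLength.b' n K)) ∧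
    (∀ n : ℕ, BraidLength.braidIndex K ≤ n →
      2 * (BraidLength.genus K : ℤ) - 1 ≤ BraidLength.b' n K) := by
  have hK := hK.isConnected
  refine ⟨fun n hn => BraidLength.isLeast_b hK.nonempty hn, BraidLength.antitoneOn_b' hK.nonempty,
    fun n hn => ?_, fun n hn => ?_⟩ <;>
  obtain ⟨w, h, hw⟩ := BraidLength.exists_represents_b'_eq hK.nonempty hn
  · exact hw ▸ h.odd hK
  · exact hw ▸ h.genus_le hK
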